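/- Let $a,b\in C^1(0,\infty)$ be real functions with $a>0$ on $(0,\infty)$, let $L=a(x)\frac{d^2}{dx^2}+b(x)\frac{d}{dx}$ be the diffusion operator on $(0,\infty)$ with reflection at $0$, fix $\theta\in(0,\infty)$, and put $$C(x)=\int_\theta^x\frac ba,\qquad \mu(dx)=\frac{e^{C(x)}}{a(x)}\,dx,\qquad \nu(dx)=e^{-C(x)}\,dx,$$ so that $L=\frac{d}{d\mu}\frac{d}{d\nu}$. Assume that $\mu(0,\infty)<\infty$ and that $C$ is bounded near $0$ (which holds, for instance, if $a$ and $b$ extend continuously to $[0,\infty)$ with $a(0)>0$). Let $\mathscr A$ be the set of (locally) absolutely continuous functions on $(0,\infty)$ and $\mathscr A_0$ the set of those $f\in\mathscr A$ with compact support in $(0,\infty)$. Define $$\lambda_1=\lambda^{NN}=\inf\Big\{\int_0^\infty f'^2e^{C}\,dx:\ f\in\mathscr A,\ \int f\,d\mu=0,\ \int f^2\,d\mu=1\Big\}.$$ With $L_S=a\frac{d^2}{dx^2}+(a'+b)\frac{d}{dx}+b'$ and $\mathscr F=\{f\in C^2(0,\infty): f(0+)=0,\ f>0 \text{ on }(0,\infty)\}$,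 define $$\lambda_S=\sup_{f\in\mathscr F}\ \inf_{x>0}\Big(-\frac{L_Sf}{f}\Big)(x)\in[-\infty,\infty].$$ Finally, let $\lambda^{*DD}$ be the Dirichlet principal eigenvalue of the dual operator $L^*=\frac{d}{d\nu}\frac{d}{d\mu}=a\frac{d^2}{dx^2}+(a'-b)\frac{d}{dx}$ on $(0,\infty)$, that is, $$\lambda^{*DD}=\inf\Big\{\int_0^\infty f'^2\,a\,e^{-C}\,dx:\ f\in\mathscr A_0,\ \int f^2\,d\nu=1\Big\}.$$ Then $$\lambda_1=\lambda_S=\lambda^{*DD}.$$ -/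

import Mathlib

open MeasureTheory Set Filter Topology
open scoped ENNReal

noncomputable section

namespace HalfLineDiffusion

/-- `C(x) = ∫_θ^x b/a` for the operator `L = a d²/dx² + b d/dx` on `(0,∞)`. -/
def logWeight (a b : ℝ → ℝ) (θ x : ℝ) : ℝ := ∫ t in θ..x, b t / a t

/-- Density `e^C / a` of the speed measure `μ`. -/
def speedDensity (a b : ℝ → ℝ) (θ x : ℝ) : ℝ := Real.exp (logWeight a b θ x) / a x

/-- Density `e^{-C}` of the scale measure `ν`. -/
def scaleDensity (a b : ℝ → ℝ) (θ x : ℝ) : ℝ := Real.exp (-logWeight a b θ x)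

/-- The measure `m(x) dx` on `(0,∞)`. -/
def halfLineMeasure (m : ℝ → ℝ) : Measure ℝ :=
  (volume.restrict (Ioi 0)).withDensity fun x => ENNReal.ofReal (m x)

/-- `f` is (locally) absolutely continuous on `(0,∞)`. -/
def LocAbsCont (f : ℝ → ℝ) : Prop :=
  ∀ x y : ℝ, 0 < x → x ≤ y → AbsolutelyContinuousOnInterval f x y

/-- The Dirichlet form of `(d/dμ)(d/dν)` on `(0,∞)`, where `ν = s(x) dx`:
`D(f) = ∫ (df/dν)² dν = ∫ f'² / s dx`. For `s = e^{-C}` it is `∫ f'² e^C dx`. -/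
def energy (s f : ℝ → ℝ) : ℝ≥0∞ :=
  ∫⁻ x in Ioi (0 : ℝ), ENNReal.ofReal (deriv f x ^ 2 / s x)

/-- `‖f‖² = ∫ f² dμ`, where `μ = m(x) dx` on `(0,∞)`. -/
def normSq (m f : ℝ → ℝ) : ℝ≥0∞ :=
  ∫⁻ x, ENNReal.ofReal (f x ^ 2) ∂(halfLineMeasure m)

/-- `λ^{NN}` of `(d/dμ)(d/dν)` on `(0,∞)`, where `μ = m(x) dx` and `ν = s(x) dx`. -/
def lamNN (m s : ℝ → ℝ) : ℝ≥0∞ :=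
  sInf {t | ∃ f : ℝ → ℝ, LocAbsCont f ∧ Integrable f (halfLineMeasure m) ∧
    ∫ x, f x ∂(halfLineMeasure m) = 0 ∧ normSq m f = 1 ∧ t = energy s f}

/-- `λ^{DD}` of `(d/dμ)(d/dν)` on `(0,∞)`, where `μ = m(x) dx` and `ν = s(x) dx`;
the test functions have compact support inside the open half-line. -/
def lamDD (m s : ℝ → ℝ) : ℝ≥0∞ :=
  sInf {t | ∃ f : ℝ → ℝ, LocAbsCont f ∧ HasCompactSupport f ∧ tsupport f ⊆ Ioi 0 ∧
    normSq m f = 1 ∧ t = energy s f}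

/-- `λ_1 = λ^{NN}` for `L = (d/dμ)(d/dν) = a d²/dx² + b d/dx`. -/
def lamOne (a b : ℝ → ℝ) (θ : ℝ) : ℝ≥0∞ :=
  lamNN (speedDensity a b θ) (scaleDensity a b θ)

/-- `λ^{*DD}`: the quantity `λ^{DD}` for the dual operator `L* = (d/dν)(d/dμ)`, in which
the speed and scale measures of `L` are exchanged. -/
def lamDualDD (a b : ℝ → ℝ) (θ : ℝ) : ℝ≥0∞ :=
  lamDD (scaleDensity a b θ) (speedDensity a b θ)

/-- `L_S f = a f'' + (a' + b) f' + b' f`. -/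
def schrodingerOp (a b f : ℝ → ℝ) (x : ℝ) : ℝ :=
  a x * deriv (deriv f) x + (deriv a x + b x) * deriv f x + deriv b x * f x

/-- `𝓕 = {f ∈ C²(0,∞) : f(0) = 0, f > 0 on (0,∞)}`, where `f(0)` is the limit `f(0+)`. -/
def testClass : Set (ℝ → ℝ) :=
  {f | ContDiffOn ℝ 2 f (Ioi 0) ∧ Tendsto f (𝓝[>] 0) (𝓝 0) ∧ ∀ x > 0, 0 < f x}

/-- `λ_S = sup_{f ∈ 𝓕} inf_{x > 0} (-L_S f / f)(x)`, taken in `[-∞, ∞]`. -/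
def lamS (a b : ℝ → ℝ) : EReal :=
  ⨆ f ∈ testClass, ⨅ x ∈ Ioi (0 : ℝ), ((-schrodingerOp a b f x / f x : ℝ) : EReal)

end HalfLineDiffusion

end

/-!
Write `m = e^C / a` and `s = e^{-C}` for the densities of the speed and scale measures. Both
equalities follow from the cycle `lamNN m s ≤ lamDD s m ≤ lamS ≤ lamNN m s`.

* `lamNN m s ≤ lamDD s m` (`lamNN_le_lamDD_dual`). The operators `f ↦ f' / s` and `g ↦ -g' / m` are
  adjoint to each other. For a test function `g` of the dual problem let `f` be the primitive of
  `s g` with mean zero. Then `∫ s g² = ∫ g f' = -∫ g' f`, and the Cauchy–Schwarz inequality compares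
  the two Rayleigh quotients.

* `lamDD s m ≤ lamS` (`lamDualDD_le_lamS`). Since `m` is integrable and `s` is bounded near `0`, the
  endpoint `0` is regular, and `g' = m p`, `p' = -lam s g`, `g(0+) = 0`, `p(0+) = 1` has a solution
  on `(0,∞)` (`exists_solution`). If `0 ≤ lam < lamDD s m`, then `g > 0` (`solution_pos`): otherwise
  `g` restricted to the interval up to its first zero would have Rayleigh quotient `lam`, and
  truncating it from below turns it into admissible test functions. Now `f = s g` is in the test
  class and `-L_S f / f` is constantly `lam`.

* `lamS ≤ lamNN m s` (`lamS_le_lamOne`). One has `L_S f = (a f' + b f)'`; so for `f` in the test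
  class, `g = f / s` and `p = a f' + b f` satisfy `g' = m p`, and `-L_S f / f ≥ lam` reads
  `-p' ≥ lam s g`. For a mean-zero `h`, the Cauchy–Schwarz inequality with weight `s g` gives
  `lam (h(y) - h(x))² ≤ (p(x) - p(y)) (H(y) - H(x))` with `H' = h'² / (s g)`. Integrating this
  against `m(x) m(y) dx dy` over a square and integrating by parts leaves a Poincaré inequality on a
  compact interval (`poincare_of_supersolution`); the intervals then exhaust the half-line.
-/

namespace HalfLineDiffusion

open scoped BoundedContinuousFunction

/-! ### Poincaré inequality on a compact interval -/

/-- Weighted Cauchy–Schwarz inequality. No integrability of `u * v` is needed, as the left-hand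
side vanishes without it. -/
theorem sq_integral_mul_le {α : Type*} [MeasurableSpace α] {μ : Measure α} {u v w : α → ℝ}
    (hw : ∀ᵐ x ∂μ, 0 < w x) (hu : Integrable (fun x => u x ^ 2 / w x) μ)
    (hv : Integrable (fun x => v x ^ 2 * w x) μ) :
    (∫ x, u x * v x ∂μ) ^ 2 ≤ (∫ x, u x ^ 2 / w x ∂μ) * ∫ x, v x ^ 2 * w x ∂μ := by
  have hA : 0 ≤ ∫ x, u x ^ 2 / w x ∂μ :=
    integral_nonneg_of_ae (hw.mono fun x hx => by positivity)
  have hB : 0 ≤ ∫ x, v x ^ 2 * w x ∂μ :=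
    integral_nonneg_of_ae (hw.mono fun x hx => by positivity)
  by_cases huv : Integrable (fun x => u x * v x) μ
  swap
  · rw [integral_undef huv]
    simpa using mul_nonneg hA hB
  have key : ∀ c : ℝ, 0 ≤ (∫ x, v x ^ 2 * w x ∂μ) * (c * c) +
      (-2 * ∫ x, u x * v x ∂μ) * c + ∫ x, u x ^ 2 / w x ∂μ := by
    intro c
    have h1 : ∫ x, (u x ^ 2 / w x + (-2 * c) * (u x * v x) + (c * c) * (v x ^ 2 * w x)) ∂μ =
        (∫ x, u x ^ 2 / w x ∂μ) + (-2 * c) * (∫ x, u x * v x ∂μ) +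
          (c * c) * ∫ x, v x ^ 2 * w x ∂μ := by
      have hu' : Integrable (fun x => u x ^ 2 / w x + (-2 * c) * (u x * v x)) μ :=
        hu.add (huv.const_mul _)
      rw [integral_add hu' (hv.const_mul _), integral_add hu (huv.const_mul _),
        integral_const_mul, integral_const_mul]
    have h2 : 0 ≤ ∫ x, (u x ^ 2 / w x + (-2 * c) * (u x * v x) +
        (c * c) * (v x ^ 2 * w x)) ∂μ := by
      refine integral_nonneg_of_ae (hw.mono fun x hx => ?_)
      have : u x ^ 2 / w x + (-2 * c) * (u x * v x) + (c * c) * (v x ^ 2 * w x) =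
          (u x - c * v x * w x) ^ 2 / w x := by
        field_simp
        ring
      change 0 ≤ u x ^ 2 / w x + (-2 * c) * (u x * v x) + (c * c) * (v x ^ 2 * w x)
      rw [this]
      positivity
    rw [h1] at h2
    linarith
  have := discrim_le_zero key
  rw [discrim] at this
  nlinarith

theorem integral_linearComb_six {α β : ℝ} {φ₁ φ₂ φ₃ φ₄ φ₅ φ₆ : ℝ → ℝ}
    (h₁ : IntervalIntegrable φ₁ volume α β) (h₂ : IntervalIntegrable φ₂ volume α β)
    (h₃ : IntervalIntegrable φ₃ volume α β) (h₄ : IntervalIntegrable φ₄ volume α β)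
    (h₅ : IntervalIntegrable φ₅ volume α β) (h₆ : IntervalIntegrable φ₆ volume α β)
    (c₁ c₂ c₃ c₄ c₅ c₆ : ℝ) :
    ∫ x in α..β, (c₁ * φ₁ x + c₂ * φ₂ x + c₃ * φ₃ x + c₄ * φ₄ x + c₅ * φ₅ x + c₆ * φ₆ x) =
      c₁ * (∫ x in α..β, φ₁ x) + c₂ * (∫ x in α..β, φ₂ x) + c₃ * (∫ x in α..β, φ₃ x) +
      c₄ * (∫ x in α..β, φ₄ x) + c₅ * (∫ x in α..β, φ₅ x) + c₆ * ∫ x in α..β, φ₆ x := by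
  replace h₁ := h₁.const_mul c₁
  replace h₂ := h₂.const_mul c₂
  replace h₃ := h₃.const_mul c₃
  replace h₄ := h₄.const_mul c₄
  replace h₅ := h₅.const_mul c₅
  replace h₆ := h₆.const_mul c₆
  rw [intervalIntegral.integral_add ((((h₁.add h₂).add h₃).add h₄).add h₅) h₆,
    intervalIntegral.integral_add (((h₁.add h₂).add h₃).add h₄) h₅,
    intervalIntegral.integral_add ((h₁.add h₂).add h₃) h₄,
    intervalIntegral.integral_add (h₁.add h₂) h₃, intervalIntegral.integral_add h₁ h₂]
  simp only [intervalIntegral.integral_const_mul]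

/-- Integrating a pointwise comparison of increments against `m(x) m(y) dx dy`: the variance of `f`
is bounded by the (negative) covariance of `p` and `H`. -/
theorem variance_le_of_increments {α β lam : ℝ} (hαβ : α ≤ β) {m f p H : ℝ → ℝ}
    (hm : ContinuousOn m (Icc α β)) (hm0 : ∀ x ∈ Icc α β, 0 ≤ m x)
    (hf : ContinuousOn f (Icc α β)) (hp : ContinuousOn p (Icc α β))
    (hH : ContinuousOn H (Icc α β))
    (h : ∀ x ∈ Icc α β, ∀ y ∈ Icc α β, lam * (f y - f x) ^ 2 ≤ (p x - p y) * (H y - H x)) :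
    lam * ((∫ x in α..β, m x) * (∫ x in α..β, m x * f x ^ 2) - (∫ x in α..β, m x * f x) ^ 2) ≤
      (∫ x in α..β, m x * p x) * (∫ x in α..β, m x * H x) -
        (∫ x in α..β, m x) * ∫ x in α..β, m x * (p x * H x) := by
  have ii : ∀ {u : ℝ → ℝ}, ContinuousOn u (Icc α β) → IntervalIntegrable u volume α β :=
    fun hu => ContinuousOn.intervalIntegrable_of_Icc hαβ hu
  have i₁ := ii hm
  have i₂ : IntervalIntegrable (fun x => m x * p x) volume α β := ii (hm.mul hp)
  have i₃ : IntervalIntegrable (fun x => m x * H x) volume α β := ii (hm.mul hH)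
  have i₄ : IntervalIntegrable (fun x => m x * (p x * H x)) volume α β := ii (hm.mul (hp.mul hH))
  have i₅ : IntervalIntegrable (fun x => m x * f x) volume α β := ii (hm.mul hf)
  have i₆ : IntervalIntegrable (fun x => m x * f x ^ 2) volume α β := ii (hm.mul (hf.pow 2))
  set M := ∫ x in α..β, m x
  set P := ∫ x in α..β, m x * p x
  set G := ∫ x in α..β, m x * H x
  set R := ∫ x in α..β, m x * (p x * H x)
  set F := ∫ x in α..β, m x * f x
  set Q := ∫ x in α..β, m x * f x ^ 2
  have inner : ∀ x ∈ Icc α β, 0 ≤ m x * ((-(p x * H x) - lam * f x ^ 2) * M + H x * P + p x * G +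
      (-1) * R + (2 * lam * f x) * F + (-lam) * Q) := by
    intro x hx
    refine mul_nonneg (hm0 x hx) ?_
    rw [← integral_linearComb_six i₁ i₂ i₃ i₄ i₅ i₆]
    refine intervalIntegral.integral_nonneg hαβ fun y hy => ?_
    have h1 := mul_nonneg (hm0 y hy) (sub_nonneg.2 (h x hx y hy))
    linarith
  have outer := intervalIntegral.integral_nonneg (μ := volume) hαβ inner
  have e : ∀ x, m x * ((-(p x * H x) - lam * f x ^ 2) * M + H x * P + p x * G +
      (-1) * R + (2 * lam * f x) * F + (-lam) * Q) =
      (-R - lam * Q) * m x + G * (m x * p x) + P * (m x * H x) + (-M) * (m x * (p x * H x)) +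
        (2 * lam * F) * (m x * f x) + (-lam * M) * (m x * f x ^ 2) := fun x => by ring
  simp only [e] at outer
  have e2 := integral_linearComb_six i₁ i₂ i₃ i₄ i₅ i₆ (-R - lam * Q) G P (-M)
    (2 * lam * F) (-lam * M)
  rw [e2] at outer
  change 0 ≤ (-R - lam * Q) * M + G * P + P * G + -M * R + 2 * lam * F * F + -lam * M * Q at outer
  nlinarith

theorem absolutelyContinuousOnInterval_of_hasDerivAt {f f' : ℝ → ℝ} {x y : ℝ}
    (hf : ∀ z ∈ uIcc x y, HasDerivAt f (f' z) z) (hf' : ContinuousOn f' (uIcc x y)) :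
    AbsolutelyContinuousOnInterval f x y := by
  obtain ⟨K, hK⟩ := isCompact_uIcc.exists_bound_of_continuousOn hf'
  have : LipschitzOnWith K.toNNReal f (uIcc x y) :=
    (convex_uIcc x y).lipschitzOnWith_of_nnnorm_hasDerivWithin_le
      (fun z hz => (hf z hz).hasDerivWithinAt) fun z hz => by
        rw [← NNReal.coe_le_coe]
        exact (hK z hz).trans (Real.le_coe_toNNReal K)
  exact this.absolutelyContinuousOnInterval

/-- Poincaré inequality on a compact interval for the measure `m dx`, out of a positive function `g`
with `g' = m p` and `-p' ≥ lam s g`. -/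
theorem poincare_of_supersolution {α β lam : ℝ} (hαβ : α ≤ β) (hlam : 0 < lam)
    {m s f g p q : ℝ → ℝ} (hm : ContinuousOn m (Icc α β)) (hm0 : ∀ x ∈ Icc α β, 0 ≤ m x)
    (hs : ContinuousOn s (Icc α β)) (hs0 : ∀ x ∈ Icc α β, 0 < s x)
    (hg0 : ∀ x ∈ Icc α β, 0 < g x) (hg : ∀ x ∈ Icc α β, HasDerivAt g (m x * p x) x)
    (hp : ∀ x ∈ Icc α β, HasDerivAt p (q x) x)
    (hq : ∀ x ∈ Icc α β, lam * (s x * g x) ≤ -q x)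
    (hf : AbsolutelyContinuousOnInterval f α β)
    (hE : IntervalIntegrable (fun x => deriv f x ^ 2 / s x) volume α β) :
    lam * ((∫ x in α..β, m x) * (∫ x in α..β, m x * f x ^ 2) - (∫ x in α..β, m x * f x) ^ 2) ≤
      (∫ x in α..β, m x) * ∫ x in α..β, deriv f x ^ 2 / s x := by
  have hgc : ContinuousOn g (Icc α β) := HasDerivAt.continuousOn hg
  have hpc : ContinuousOn p (Icc α β) := HasDerivAt.continuousOn hp
  have hwc : ContinuousOn (fun x => s x * g x) (Icc α β) := hs.mul hgc
  have hw0 : ∀ x ∈ Icc α β, 0 < s x * g x := fun x hx => mul_pos (hs0 x hx) (hg0 x hx)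
  have hk : IntervalIntegrable (fun x => deriv f x ^ 2 / (s x * g x)) volume α β := by
    have h1 : ContinuousOn (fun x => (g x)⁻¹) (uIcc α β) := by
      rw [uIcc_of_le hαβ]
      exact hgc.inv₀ fun x hx => (hg0 x hx).ne'
    refine (hE.mul_continuousOn h1).congr fun x _ => ?_
    simp only [div_eq_mul_inv, mul_inv, mul_assoc]
  set H : ℝ → ℝ := fun t => ∫ x in α..t, deriv f x ^ 2 / (s x * g x)
  have hHac : AbsolutelyContinuousOnInterval H α β :=
    hk.absolutelyContinuousOnInterval_intervalIntegral left_mem_uIcc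
  have hHc : ContinuousOn H (Icc α β) := uIcc_of_le hαβ ▸ hHac.continuousOn
  have hksub : ∀ x ∈ Icc α β, ∀ y ∈ Icc α β,
      IntervalIntegrable (fun x => deriv f x ^ 2 / (s x * g x)) volume x y := fun x hx y hy =>
    hk.mono_set (by rw [uIcc_of_le hαβ]; exact uIcc_subset_Icc hx hy)
  have hHsub : ∀ x ∈ Icc α β, ∀ y ∈ Icc α β,
      H y - H x = ∫ t in x..y, deriv f t ^ 2 / (s t * g t) := fun x hx y hy => by
    have hα : α ∈ Icc α β := left_mem_Icc.2 hαβ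
    exact intervalIntegral.integral_interval_sub_left (hksub α hα y hy) (hksub α hα x hx)
  have hHmono : ∀ x ∈ Icc α β, ∀ y ∈ Icc α β, x ≤ y → H x ≤ H y := fun x hx y hy hxy => by
    rw [← sub_nonneg, hHsub x hx y hy]
    refine intervalIntegral.integral_nonneg hxy fun t ht => ?_
    have := hw0 t ⟨hx.1.trans ht.1, ht.2.trans hy.2⟩
    positivity
  have hα : α ∈ Icc α β := left_mem_Icc.2 hαβ
  have hβ : β ∈ Icc α β := right_mem_Icc.2 hαβ
  -- Cauchy–Schwarz with the weight `s g`, whose integral is controlled by the increment of `p`.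
  have pair : ∀ x ∈ Icc α β, ∀ y ∈ Icc α β, x ≤ y →
      lam * (f y - f x) ^ 2 ≤ (p x - p y) * (H y - H x) := by
    intro x hx y hy hxy
    have hsub : Icc x y ⊆ Icc α β := Icc_subset_Icc hx.1 hy.2
    have hp' : lam * ∫ t in x..y, s t * g t ≤ p x - p y := by
      have h1 : ∫ t in x..y, lam * (s t * g t) ≤ -p y - -p x :=
        intervalIntegral.integral_le_sub_of_hasDeriv_right_of_le (g := fun t => -p t)
          (g' := fun t => -q t) hxy (hpc.mono hsub).neg
          (fun t ht => (hp t (hsub (Ioo_subset_Icc_self ht))).neg.hasDerivWithinAt)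
          ((continuousOn_const.mul (hwc.mono hsub)).integrableOn_Icc)
          (fun t ht => hq t (hsub (Ioo_subset_Icc_self ht)))
      rw [intervalIntegral.integral_const_mul] at h1
      linarith
    have hcs := sq_integral_mul_le (μ := volume.restrict (Ioc x y)) (u := deriv f)
      (v := fun _ => 1) (w := fun t => s t * g t)
      ((ae_restrict_iff' measurableSet_Ioc).2 (ae_of_all _ fun t ht =>
        hw0 t (hsub (Ioc_subset_Icc_self ht))))
      ((intervalIntegrable_iff_integrableOn_Ioc_of_le hxy).1 (hksub x hx y hy))
      (by
        simp only [one_pow, one_mul]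
        exact ((hwc.mono hsub).integrableOn_Icc).mono_set Ioc_subset_Icc_self)
    simp only [one_pow, one_mul, mul_one] at hcs
    rw [← intervalIntegral.integral_of_le hxy, ← intervalIntegral.integral_of_le hxy,
      ← intervalIntegral.integral_of_le hxy, ← hHsub x hx y hy,
      (hf.mono (by rw [uIcc_of_le hαβ, uIcc_of_le hxy]; exact hsub)).integral_deriv_eq_sub] at hcs
    have h2 := sub_nonneg.2 (hHmono x hx y hy hxy)
    nlinarith
  have pair' : ∀ x ∈ Icc α β, ∀ y ∈ Icc α β,
      lam * (f y - f x) ^ 2 ≤ (p x - p y) * (H y - H x) := by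
    intro x hx y hy
    rcases le_total x y with h | h
    · exact pair x hx y hy h
    · have := pair y hy x hx h
      nlinarith
  have main := variance_le_of_increments hαβ hm hm0 (uIcc_of_le hαβ ▸ hf.continuousOn) hpc hHc pair'
  have hmp : ∫ x in α..β, m x * p x = g β - g α :=
    intervalIntegral.integral_eq_sub_of_hasDerivAt_of_le hαβ hgc
      (fun x hx => hg x (Ioo_subset_Icc_self hx))
      ((hm.mul hpc).intervalIntegrable_of_Icc hαβ)
  have hgac : AbsolutelyContinuousOnInterval g α β :=
    absolutelyContinuousOnInterval_of_hasDerivAt (f' := fun x => m x * p x)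
      (by rwa [uIcc_of_le hαβ]) (by rw [uIcc_of_le hαβ]; exact hm.mul hpc)
  have hibp := hgac.integral_mul_deriv_eq_deriv_mul hHac
  have hH0 : H α = 0 := intervalIntegral.integral_same
  have e1 : ∫ x in α..β, g x * deriv H x = ∫ x in α..β, deriv f x ^ 2 / s x := by
    refine intervalIntegral.integral_congr_ae ?_
    filter_upwards [hk.ae_hasDerivAt_integral] with x hx hx'
    have hx'' := uIoc_subset_uIcc hx'
    rw [(hx hx'' α left_mem_uIcc).deriv]
    rw [uIcc_of_le hαβ] at hx''
    have := hg0 x hx''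
    have := hs0 x hx''
    field_simp
  have e2 : ∫ x in α..β, deriv g x * H x = ∫ x in α..β, m x * (p x * H x) := by
    refine intervalIntegral.integral_congr fun x hx => ?_
    rw [uIcc_of_le hαβ] at hx
    simp only [(hg x hx).deriv, mul_assoc]
  rw [e1, e2, hH0, mul_zero, sub_zero] at hibp
  have hG : ∫ x in α..β, m x * H x ≤ (∫ x in α..β, m x) * H β := by
    rw [← intervalIntegral.integral_mul_const]
    refine intervalIntegral.integral_mono_on hαβ ((hm.mul hHc).intervalIntegrable_of_Icc hαβ)
      ((hm.mul continuousOn_const).intervalIntegrable_of_Icc hαβ) fun x hx =>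
      mul_le_mul_of_nonneg_left (hHmono x hx β hβ hx.2) (hm0 x hx)
  have hG0 : 0 ≤ ∫ x in α..β, m x * H x :=
    intervalIntegral.integral_nonneg hαβ fun x hx =>
      mul_nonneg (hm0 x hx) (hH0 ▸ hHmono α hα x hx hx.1)
  have h3 := mul_nonneg (hg0 α hα).le hG0
  have h4 := mul_le_mul_of_nonneg_left hG (hg0 β hβ).le
  rw [hmp] at main
  rw [hibp]
  linarith

/-! ### Norms and energies as integrals over the half-line -/

section Conversion

variable {m s f : ℝ → ℝ}

theorem normSq_eq_lintegral (hm : ContinuousOn m (Ioi 0)) (f : ℝ → ℝ) :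
    normSq m f = ∫⁻ x in Ioi (0 : ℝ), ENNReal.ofReal (m x * f x ^ 2) := by
  rw [normSq, halfLineMeasure, lintegral_withDensity_eq_lintegral_mul_non_measurable₀ _
    (hm.aemeasurable measurableSet_Ioi).ennreal_ofReal (ae_of_all _ fun _ => ENNReal.ofReal_lt_top)]
  refine lintegral_congr fun x => ?_
  rw [Pi.mul_apply, ENNReal.ofReal_mul' (sq_nonneg _)]

theorem integrable_halfLineMeasure_iff (hm : ContinuousOn m (Ioi 0)) (hm0 : ∀ x > 0, 0 < m x) :
    Integrable f (halfLineMeasure m) ↔ IntegrableOn (fun x => m x * f x) (Ioi 0) := by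
  rw [halfLineMeasure, integrable_withDensity_iff_integrable_smul₀'
    (hm.aemeasurable measurableSet_Ioi).ennreal_ofReal (ae_of_all _ fun _ => ENNReal.ofReal_lt_top)]
  refine integrableOn_congr_fun (fun x hx => ?_) measurableSet_Ioi
  rw [ENNReal.toReal_ofReal (hm0 x hx).le, smul_eq_mul]

theorem integral_halfLineMeasure (hm : ContinuousOn m (Ioi 0)) (hm0 : ∀ x > 0, 0 < m x)
    (f : ℝ → ℝ) : ∫ x, f x ∂(halfLineMeasure m) = ∫ x in Ioi (0 : ℝ), m x * f x := by
  rw [halfLineMeasure, integral_withDensity_eq_integral_toReal_smul₀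
    (hm.aemeasurable measurableSet_Ioi).ennreal_ofReal (ae_of_all _ fun _ => ENNReal.ofReal_lt_top)]
  refine setIntegral_congr_fun measurableSet_Ioi (fun x hx => ?_)
  simp only [ENNReal.toReal_ofReal (hm0 x hx).le, smul_eq_mul]

theorem LocAbsCont.continuousOn (hf : LocAbsCont f) : ContinuousOn f (Ioi 0) := by
  intro x hx
  have hx : 0 < x := hx
  have h := (hf (x / 2) (x + 1) (by linarith) (by linarith)).continuousOn
  rw [uIcc_of_le (by linarith)] at h
  exact (h.continuousAt (Icc_mem_nhds (by linarith) (by linarith))).continuousWithinAt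

theorem LocAbsCont.of_hasDerivAt {f' : ℝ → ℝ} (hf : ∀ x > 0, HasDerivAt f (f' x) x)
    (hf' : ContinuousOn f' (Ioi 0)) : LocAbsCont f := fun x y hx hxy => by
  have h : uIcc x y ⊆ Ioi 0 := by
    rw [uIcc_of_le hxy]
    exact fun z hz => hx.trans_le hz.1
  exact absolutelyContinuousOnInterval_of_hasDerivAt (fun z hz => hf z (h hz)) (hf'.mono h)

/-- A function of finite energy has `f'² / s` integrable. -/
theorem integrableOn_energy (hs : ContinuousOn s (Ioi 0)) (hs0 : ∀ x > 0, 0 < s x)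
    (h : energy s f ≠ ⊤) : IntegrableOn (fun x => deriv f x ^ 2 / s x) (Ioi 0) ∧
      energy s f = ENNReal.ofReal (∫ x in Ioi (0 : ℝ), deriv f x ^ 2 / s x) := by
  have h0 : 0 ≤ᵐ[volume.restrict (Ioi 0)] fun x => deriv f x ^ 2 / s x :=
    (ae_restrict_iff' measurableSet_Ioi).2 (ae_of_all _ fun x hx =>
      div_nonneg (sq_nonneg _) (hs0 x hx).le)
  have hmeas : AEStronglyMeasurable (fun x => deriv f x ^ 2 / s x) (volume.restrict (Ioi 0)) :=
    (((measurable_deriv f).pow_const 2).aemeasurable.div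
      (hs.aemeasurable measurableSet_Ioi)).aestronglyMeasurable
  have hi : IntegrableOn (fun x => deriv f x ^ 2 / s x) (Ioi 0) :=
    (lintegral_ofReal_ne_top_iff_integrable hmeas h0).1 h
  exact ⟨hi, (ofReal_integral_eq_lintegral_ofReal hi h0).symm⟩

theorem integrableOn_normSq (hm : ContinuousOn m (Ioi 0)) (hm0 : ∀ x > 0, 0 < m x)
    (hf : ContinuousOn f (Ioi 0)) (h : normSq m f ≠ ⊤) :
    IntegrableOn (fun x => m x * f x ^ 2) (Ioi 0) := by
  rw [normSq_eq_lintegral hm] at h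
  refine (lintegral_ofReal_ne_top_iff_integrable ?_ ?_).1 h
  · exact (hm.mul (hf.pow 2)).aestronglyMeasurable measurableSet_Ioi
  · exact (ae_restrict_iff' measurableSet_Ioi).2 (ae_of_all _ fun x hx =>
      mul_nonneg (hm0 x hx).le (sq_nonneg _))

theorem normSq_eq_ofReal (hm : ContinuousOn m (Ioi 0)) (hm0 : ∀ x > 0, 0 < m x)
    (h : IntegrableOn (fun x => m x * f x ^ 2) (Ioi 0)) :
    normSq m f = ENNReal.ofReal (∫ x in Ioi (0 : ℝ), m x * f x ^ 2) := by
  rw [normSq_eq_lintegral hm]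
  exact (ofReal_integral_eq_lintegral_ofReal h ((ae_restrict_iff' measurableSet_Ioi).2
    (ae_of_all _ fun x hx => mul_nonneg (hm0 x hx).le (sq_nonneg _)))).symm

theorem energy_const_mul (s f : ℝ → ℝ) (c : ℝ) :
    energy s (fun x => c * f x) = ENNReal.ofReal (c ^ 2) * energy s f := by
  rw [energy, energy, ← lintegral_const_mul' _ _ ENNReal.ofReal_ne_top]
  refine lintegral_congr fun x => ?_
  rw [deriv_const_mul_field, ← ENNReal.ofReal_mul (sq_nonneg c)]
  congr 1
  ring

theorem normSq_const_mul (m f : ℝ → ℝ) (c : ℝ) :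
    normSq m (fun x => c * f x) = ENNReal.ofReal (c ^ 2) * normSq m f := by
  rw [normSq, normSq, ← lintegral_const_mul' _ _ ENNReal.ofReal_ne_top]
  refine lintegral_congr fun x => ?_
  rw [← ENNReal.ofReal_mul (sq_nonneg c)]
  congr 1
  ring

theorem exists_sq_mul_eq_one {N : ℝ≥0∞} (h0 : N ≠ 0) (h : N ≠ ⊤) :
    ∃ c : ℝ, ENNReal.ofReal (c ^ 2) * N = 1 := by
  have hN := ENNReal.toReal_pos h0 h
  refine ⟨(Real.sqrt N.toReal)⁻¹, ?_⟩
  rw [inv_pow, Real.sq_sqrt hN.le, ENNReal.ofReal_inv_of_pos hN, ENNReal.ofReal_toReal h,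
    ENNReal.inv_mul_cancel h0 h]

/-- The Rayleigh quotient characterisation of `lamNN`, without the normalisation `‖f‖ = 1`. -/
theorem lamNN_mul_normSq_le (hf : LocAbsCont f) (hi : Integrable f (halfLineMeasure m))
    (hmean : ∫ x, f x ∂(halfLineMeasure m) = 0) (hN : normSq m f ≠ ⊤) :
    lamNN m s * normSq m f ≤ energy s f := by
  by_cases h0 : normSq m f = 0
  · simp [h0]
  obtain ⟨c, hc⟩ := exists_sq_mul_eq_one h0 hN
  have h : lamNN m s ≤ ENNReal.ofReal (c ^ 2) * energy s f :=
    sInf_le ⟨fun x => c * f x, fun x y hx hxy => (hf x y hx hxy).const_mul c, hi.const_mul c,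
      by rw [integral_const_mul, hmean, mul_zero], by rw [normSq_const_mul, hc],
      (energy_const_mul s f c).symm⟩
  calc lamNN m s * normSq m f ≤ ENNReal.ofReal (c ^ 2) * energy s f * normSq m f := by gcongr
    _ = ENNReal.ofReal (c ^ 2) * normSq m f * energy s f := by ring
    _ = energy s f := by rw [hc, one_mul]

/-- The Rayleigh quotient characterisation of `lamDD`, without the normalisation `‖f‖ = 1`. -/
theorem lamDD_mul_normSq_le (hf : LocAbsCont f) (hc : HasCompactSupport f)
    (hsupp : tsupport f ⊆ Ioi 0) (hN : normSq m f ≠ ⊤) :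
    lamDD m s * normSq m f ≤ energy s f := by
  by_cases h0 : normSq m f = 0
  · simp [h0]
  obtain ⟨c, hc'⟩ := exists_sq_mul_eq_one h0 hN
  have h : lamDD m s ≤ ENNReal.ofReal (c ^ 2) * energy s f :=
    sInf_le ⟨fun x => c * f x, fun x y hx hxy => (hf x y hx hxy).const_mul c,
      hc.mul_left, (tsupport_mul_subset_right (f := fun _ => c)).trans hsupp,
      by rw [normSq_const_mul, hc'], (energy_const_mul s f c).symm⟩
  calc lamDD m s * normSq m f ≤ ENNReal.ofReal (c ^ 2) * energy s f * normSq m f := by gcongr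
    _ = ENNReal.ofReal (c ^ 2) * normSq m f * energy s f := by ring
    _ = energy s f := by rw [hc', one_mul]

theorem tendsto_intervalIntegral_exhaustion {F : ℝ → ℝ} (hF : IntegrableOn F (Ioi 0)) :
    Tendsto (fun n : ℕ => ∫ x in (1 / ((n : ℝ) + 1))..((n : ℝ) + 1), F x) atTop
      (𝓝 (∫ x in Ioi (0 : ℝ), F x)) := by
  have hcov : AECover (volume.restrict (Ioi (0 : ℝ))) atTop fun n : ℕ =>
      Ioi (1 / ((n : ℝ) + 1)) ∩ Iic ((n : ℝ) + 1) :=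
    (aecover_Ioi_of_Ioi tendsto_one_div_add_atTop_nhds_zero_nat).inter
      (aecover_Iic (tendsto_natCast_atTop_atTop.atTop_add tendsto_const_nhds))
  refine (hcov.integral_tendsto_of_countably_generated hF).congr fun n => ?_
  have hn : (0 : ℝ) < (n : ℝ) + 1 := by positivity
  rw [Ioi_inter_Iic, Measure.restrict_restrict measurableSet_Ioc,
    intervalIntegral.integral_of_le, inter_eq_left.2]
  · exact fun x hx => lt_trans (by positivity) hx.1
  · rw [div_le_iff₀ hn]
    nlinarith [n.cast_nonneg (α := ℝ)]

end Conversion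

/-! ### The Neumann eigenvalue is bounded below by supersolutions -/

theorem integral_Ioi_pos {m : ℝ → ℝ} (hm0 : ∀ x > 0, 0 < m x)
    (hmi : IntegrableOn m (Ioi 0)) : 0 < ∫ x in Ioi (0 : ℝ), m x := by
  rw [setIntegral_pos_iff_support_of_nonneg_ae _ hmi]
  · have : Function.support m ∩ Ioi 0 = Ioi 0 :=
      inter_eq_right.2 fun x hx => (hm0 x hx).ne'
    rw [this]
    simp
  · exact (ae_restrict_iff' measurableSet_Ioi).2 (ae_of_all _ fun x hx => (hm0 x hx).le)

/-- A positive `g` with `g' = m p` and `-p' ≥ lam s g` bounds `lamNN` from below; no boundary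
condition on `g` is needed. -/
theorem ofReal_le_lamNN_of_supersolution {lam : ℝ} (hlam : 0 < lam) {m s g p q : ℝ → ℝ}
    (hm : ContinuousOn m (Ioi 0)) (hm0 : ∀ x > 0, 0 < m x) (hmi : IntegrableOn m (Ioi 0))
    (hs : ContinuousOn s (Ioi 0)) (hs0 : ∀ x > 0, 0 < s x)
    (hg0 : ∀ x > 0, 0 < g x) (hg : ∀ x > 0, HasDerivAt g (m x * p x) x)
    (hp : ∀ x > 0, HasDerivAt p (q x) x) (hq : ∀ x > 0, lam * (s x * g x) ≤ -q x) :
    ENNReal.ofReal lam ≤ lamNN m s := by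
  refine le_sInf ?_
  rintro t ⟨f, hf, hi, hmean, hnorm, rfl⟩
  by_cases hE : energy s f = ⊤
  · simp [hE]
  obtain ⟨hEi, hEeq⟩ := integrableOn_energy hs hs0 hE
  rw [integrable_halfLineMeasure_iff hm hm0] at hi
  rw [integral_halfLineMeasure hm hm0] at hmean
  have hNi := integrableOn_normSq hm hm0 hf.continuousOn (by simp [hnorm])
  rw [normSq_eq_ofReal hm hm0 hNi, ENNReal.ofReal_eq_one] at hnorm
  rw [hEeq]
  refine ENNReal.ofReal_le_ofReal ?_
  have hM := integral_Ioi_pos hm0 hmi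
  have tm := tendsto_intervalIntegral_exhaustion hmi
  have key := le_of_tendsto_of_tendsto'
    (((tm.mul (tendsto_intervalIntegral_exhaustion hNi)).sub
      ((tendsto_intervalIntegral_exhaustion hi).pow 2)).const_mul lam)
    (tm.mul (tendsto_intervalIntegral_exhaustion hEi)) fun n => by
      have hn : (0 : ℝ) < (n : ℝ) + 1 := by positivity
      have hle : 1 / ((n : ℝ) + 1) ≤ (n : ℝ) + 1 := by
        rw [div_le_iff₀ hn]
        nlinarith [n.cast_nonneg (α := ℝ)]
      have hpos : (0 : ℝ) < 1 / ((n : ℝ) + 1) := by positivity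
      have hsub : Icc (1 / ((n : ℝ) + 1)) ((n : ℝ) + 1) ⊆ Ioi 0 := fun x hx => hpos.trans_le hx.1
      exact poincare_of_supersolution hle hlam (hm.mono hsub) (fun x hx => (hm0 x (hsub hx)).le)
        (hs.mono hsub) (fun x hx => hs0 x (hsub hx)) (fun x hx => hg0 x (hsub hx))
        (fun x hx => hg x (hsub hx)) (fun x hx => hp x (hsub hx)) (fun x hx => hq x (hsub hx))
        (hf _ _ hpos hle)
        ((intervalIntegrable_iff_integrableOn_Ioc_of_le hle).2
          (hEi.mono_set (Ioc_subset_Icc_self.trans hsub)))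
  rw [hmean, hnorm] at key
  nlinarith

/-! ### The Neumann eigenvalue is at most the dual Dirichlet eigenvalue -/

theorem exists_Ioo_of_hasCompactSupport {g : ℝ → ℝ} (hc : HasCompactSupport g)
    (hsupp : tsupport g ⊆ Ioi 0) :
    ∃ α β : ℝ, 0 < α ∧ α < β ∧ ∀ x, x ∉ Ioo α β → g x = 0 := by
  rcases (tsupport g).eq_empty_or_nonempty with he | hne
  · exact ⟨1, 2, one_pos, one_lt_two, fun x _ => image_eq_zero_of_notMem_tsupport (by simp [he])⟩
  · obtain ⟨l, hl, hl'⟩ := hc.isCompact.exists_isLeast hne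
    obtain ⟨r, hr, hr'⟩ := hc.isCompact.exists_isGreatest hne
    have hl0 : 0 < l := hsupp hl
    have hlr : l ≤ r := hl' hr
    refine ⟨l / 2, r + 1, by linarith, by linarith, fun x hx => ?_⟩
    refine image_eq_zero_of_notMem_tsupport fun hmem => hx ⟨?_, ?_⟩
    · linarith [hl' hmem]
    · linarith [hr' hmem]

/-- If `g` is a test function for the dual problem, the mean-zero primitive `f` of `s g` satisfies
`energy s f = normSq s g` and `(normSq s g)² ≤ energy m g * normSq m f`, by integration by parts
and Cauchy–Schwarz. -/
theorem lamNN_le_lamDD_dual {m s : ℝ → ℝ}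
    (hm : ContinuousOn m (Ioi 0)) (hm0 : ∀ x > 0, 0 < m x) (hmi : IntegrableOn m (Ioi 0))
    (hs : ContinuousOn s (Ioi 0)) (hs0 : ∀ x > 0, 0 < s x) :
    lamNN m s ≤ lamDD s m := by
  refine le_sInf ?_
  rintro t ⟨g, hg, hgc, hgs, hgn, rfl⟩
  by_cases hE : energy m g = ⊤
  · simp [hE]
  obtain ⟨hEi, hEeq⟩ := integrableOn_energy hm hm0 hE
  obtain ⟨α, β, hα, hαβ, hg0⟩ := exists_Ioo_of_hasCompactSupport hgc hgs
  have hsub : Icc α β ⊆ Ioi 0 := fun x hx => hα.trans_le hx.1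
  have hgcont := hg.continuousOn
  have hk : ContinuousOn (fun x => s x * g x) (Ioi 0) := hs.mul hgcont
  set u : ℝ → ℝ := fun x => ∫ t in α..x, s t * g t with hu
  have hkint : ∀ x > 0, IntervalIntegrable (fun x => s x * g x) volume α x := fun x hx =>
    (hk.mono fun y hy => lt_of_lt_of_le (lt_min hα hx) hy.1).intervalIntegrable
  have hud : ∀ x > 0, HasDerivAt u (s x * g x) x := fun x hx =>
    intervalIntegral.integral_hasDerivAt_right (hkint x hx)
      (hk.stronglyMeasurableAtFilter isOpen_Ioi x hx) (hk.continuousAt (Ioi_mem_nhds hx))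
  -- Outside the support of `g` the primitive is constant, hence it is bounded.
  obtain ⟨B, hB⟩ := isCompact_Icc.exists_bound_of_continuousOn
    (HasDerivAt.continuousOn fun x hx => hud x (hsub hx) : ContinuousOn u (Icc α β))
  have huB : ∀ x > 0, ‖u x‖ ≤ B := by
    intro x hx
    rcases lt_or_ge x α with h | h
    · have : u x = u α := by
        have h1 : u x = ∫ t in α..x, (0 : ℝ) := by
          refine intervalIntegral.integral_congr fun y hy => ?_
          rw [uIcc_of_ge h.le] at hy
          simp only [hg0 y (fun hy' => absurd hy'.1 (not_lt.2 hy.2)), mul_zero]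
        rw [h1]
        simp [hu]
      rw [this]
      exact hB α (left_mem_Icc.2 hαβ.le)
    · rcases le_or_gt x β with h' | h'
      · exact hB x ⟨h, h'⟩
      · have : u x = u β := by
          have h1 : u x = u β + ∫ t in β..x, s t * g t :=
            (intervalIntegral.integral_add_adjacent_intervals (hkint β (hα.trans hαβ))
              ((hkint β (hα.trans hαβ)).symm.trans (hkint x hx))).symm
          have h2 : ∫ t in β..x, s t * g t = ∫ t in β..x, (0 : ℝ) := by
            refine intervalIntegral.integral_congr fun y hy => ?_
            rw [uIcc_of_le h'.le] at hy
            simp only [hg0 y (fun hy' => absurd hy'.2 (not_lt.2 hy.1)), mul_zero]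
          rw [h1, h2]
          simp
        rw [this]
        exact hB β (right_mem_Icc.2 hαβ.le)
  have hucont : ContinuousOn u (Ioi 0) := HasDerivAt.continuousOn hud
  set M := ∫ x in Ioi (0 : ℝ), m x with hMdef
  have hM : 0 < M := integral_Ioi_pos hm0 hmi
  have hbdd : ∀ {v : ℝ → ℝ} {K : ℝ}, ContinuousOn v (Ioi 0) → (∀ x > 0, ‖v x‖ ≤ K) →
      IntegrableOn (fun x => m x * v x) (Ioi 0) := fun hv hK =>
    Integrable.mul_bdd hmi (hv.aestronglyMeasurable measurableSet_Ioi)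
      ((ae_restrict_iff' measurableSet_Ioi).2 (ae_of_all _ fun x hx => hK x hx))
  have hmu := hbdd hucont huB
  set c := (∫ x in Ioi (0 : ℝ), m x * u x) / M with hc
  set f : ℝ → ℝ := fun x => u x - c with hf
  have hfd : ∀ x > 0, HasDerivAt f (s x * g x) x := fun x hx => (hud x hx).sub_const c
  have hfcont : ContinuousOn f (Ioi 0) := HasDerivAt.continuousOn hfd
  have hfB : ∀ x > 0, ‖f x‖ ≤ B + ‖c‖ := fun x hx =>
    (norm_sub_le _ _).trans (by gcongr; exact huB x hx)
  have hfac : LocAbsCont f := LocAbsCont.of_hasDerivAt hfd hk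
  have hmf : IntegrableOn (fun x => m x * f x) (Ioi 0) := hbdd hfcont hfB
  have hmf2 : IntegrableOn (fun x => m x * f x ^ 2) (Ioi 0) :=
    hbdd (hfcont.pow 2) (K := (B + ‖c‖) ^ 2) fun x hx => by
      rw [norm_pow]
      exact pow_le_pow_left₀ (norm_nonneg _) (hfB x hx) 2
  have hmean : ∫ x in Ioi (0 : ℝ), m x * f x = 0 := by
    have e : ∀ x, m x * f x = m x * u x - m x * c := fun x => by simp only [hf]; ring
    simp only [e]
    rw [integral_sub hmu (hmi.mul_const c), integral_mul_const, ← hMdef, hc]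
    field_simp
    ring
  set N := ∫ x in Ioi (0 : ℝ), m x * f x ^ 2 with hN
  have hfN : normSq m f = ENNReal.ofReal N := normSq_eq_ofReal hm hm0 hmf2
  have hfE : energy s f = 1 := by
    rw [← hgn, normSq_eq_lintegral hs, energy]
    refine setLIntegral_congr_fun measurableSet_Ioi fun x hx => ?_
    have := hs0 x hx
    simp only [(hfd x hx).deriv]
    congr 1
    field_simp
  -- `1 = ∫ s g² = -∫ g' f`
  have hgi := integrableOn_normSq hs hs0 hgcont (by simp [hgn])
  rw [normSq_eq_ofReal hs hs0 hgi, ENNReal.ofReal_eq_one] at hgn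
  have hgα : g α = 0 := hg0 α fun h => lt_irrefl _ h.1
  have hgβ : g β = 0 := hg0 β fun h => lt_irrefl _ h.2
  have hibp := (hg α β hα hαβ.le).integral_mul_deriv_eq_deriv_mul (hfac α β hα hαβ.le)
  rw [hgα, hgβ, zero_mul, zero_mul, sub_zero, zero_sub] at hibp
  have e1 : ∫ x in α..β, g x * deriv f x = 1 := by
    rw [intervalIntegral.integral_of_le hαβ.le, ← hgn]
    have h1 : ∫ x in Ioi (0 : ℝ), s x * g x ^ 2 = ∫ x in Ioc α β, s x * g x ^ 2 := by
      refine setIntegral_eq_of_subset_of_forall_sdiff_eq_zero measurableSet_Ioi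
        (Ioc_subset_Icc_self.trans hsub) fun x hx => ?_
      rw [hg0 x fun h => hx.2 (Ioo_subset_Ioc_self h)]
      ring
    rw [h1]
    refine setIntegral_congr_fun measurableSet_Ioc fun x hx => ?_
    simp only [(hfd x (hsub (Ioc_subset_Icc_self hx))).deriv]
    ring
  have hIoc : Ioc α β ⊆ Ioi 0 := Ioc_subset_Icc_self.trans hsub
  have hmf2' : IntegrableOn (fun x => f x ^ 2 * m x) (Ioi 0) := by simpa only [mul_comm] using hmf2
  have hcs := sq_integral_mul_le (μ := volume.restrict (Ioc α β)) (u := deriv g) (v := f) (w := m)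
    ((ae_restrict_iff' measurableSet_Ioc).2 (ae_of_all _ fun x hx => hm0 x (hIoc hx)))
    (hEi.mono_set hIoc) (hmf2'.mono_set hIoc)
  rw [e1] at hibp
  rw [← intervalIntegral.integral_of_le hαβ.le, show ∫ x in α..β, deriv g x * f x = -1 by linarith]
    at hcs
  have b1 : ∫ x in Ioc α β, deriv g x ^ 2 / m x ≤ ∫ x in Ioi (0 : ℝ), deriv g x ^ 2 / m x :=
    setIntegral_mono_set hEi ((ae_restrict_iff' measurableSet_Ioi).2 (ae_of_all _ fun x hx =>
      div_nonneg (sq_nonneg _) (hm0 x hx).le)) hIoc.eventuallyLE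
  have b2 : ∫ x in Ioc α β, f x ^ 2 * m x ≤ N := by
    rw [hN]
    simp only [mul_comm (m _)]
    exact setIntegral_mono_set hmf2' ((ae_restrict_iff' measurableSet_Ioi).2
      (ae_of_all _ fun x hx => mul_nonneg (sq_nonneg _) (hm0 x hx).le)) hIoc.eventuallyLE
  set E := ∫ x in Ioi (0 : ℝ), deriv g x ^ 2 / m x
  have hE0 : 0 ≤ E := setIntegral_nonneg measurableSet_Ioi fun x hx =>
    div_nonneg (sq_nonneg _) (hm0 x hx).le
  have hN0 : 0 ≤ N := setIntegral_nonneg measurableSet_Ioi fun x hx =>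
    mul_nonneg (hm0 x hx).le (sq_nonneg _)
  have hEN : 1 ≤ E * N := by
    have b0 : 0 ≤ ∫ x in Ioc α β, f x ^ 2 * m x := setIntegral_nonneg measurableSet_Ioc fun x hx =>
      mul_nonneg (sq_nonneg _) (hm0 x (hIoc hx)).le
    have := mul_le_mul b1 b2 b0 hE0
    linarith
  have hNpos : 0 < N := by
    rcases hN0.lt_or_eq with h | h
    · exact h
    · rw [← h, mul_zero] at hEN
      linarith
  have hR := lamNN_mul_normSq_le (m := m) (s := s) hfac
    ((integrable_halfLineMeasure_iff hm hm0).2 hmf)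
    (by rw [integral_halfLineMeasure hm hm0, hmean]) (by rw [hfN]; exact ENNReal.ofReal_ne_top)
  rw [hfE, hfN] at hR
  rw [hEeq]
  have h2 : lamNN m s * ENNReal.ofReal N ≤ ENNReal.ofReal E * ENNReal.ofReal N := by
    rw [← ENNReal.ofReal_mul hE0]
    exact hR.trans (by rwa [ENNReal.one_le_ofReal])
  exact (ENNReal.mul_le_mul_iff_left (ENNReal.ofReal_pos.2 hNpos).ne' ENNReal.ofReal_ne_top).1 h2

/-! ### The initial value problem at the regular endpoint `0` -/

theorem hasDerivAt_primitive {k : ℝ → ℝ} (hk : ∀ x, IntervalIntegrable k volume 0 x)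
    (hkc : ContinuousOn k (Ioi 0)) {x : ℝ} (hx : 0 < x) :
    HasDerivAt (fun y => ∫ t in (0 : ℝ)..y, k t) (k x) x :=
  intervalIntegral.integral_hasDerivAt_right (hk x)
    (hkc.stronglyMeasurableAtFilter isOpen_Ioi x hx) (hkc.continuousAt (Ioi_mem_nhds hx))

/-- With `S(x) = ∫_0^x s`, one has `∫_0^x s e^{K S} ≤ e^{K S(x)} / K`. -/
theorem integral_mul_exp_primitive_le {s : ℝ → ℝ} (hsi : ∀ a b, IntervalIntegrable s volume a b)
    (hsc : ContinuousOn s (Ioi 0)) {K x : ℝ} (hK : 0 < K) (hx : 0 ≤ x) :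
    ∫ t in (0 : ℝ)..x, s t * Real.exp (K * ∫ r in (0 : ℝ)..t, s r) ≤
      Real.exp (K * ∫ r in (0 : ℝ)..x, s r) / K := by
  have hS : Continuous fun t => ∫ r in (0 : ℝ)..t, s r :=
    intervalIntegral.continuous_primitive hsi 0
  have hw : Continuous fun t => Real.exp (K * ∫ r in (0 : ℝ)..t, s r) := by fun_prop
  have h := intervalIntegral.integral_eq_sub_of_hasDerivAt_of_le hx hw.continuousOn
    (f' := fun t => K * (s t * Real.exp (K * ∫ r in (0 : ℝ)..t, s r)))
    (fun t ht => by
      have := ((hasDerivAt_primitive (hsi 0) hsc ht.1).const_mul K).exp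
      exact this.congr_deriv (by ring))
    (((hsi 0 x).mul_continuousOn hw.continuousOn).const_mul K)
  rw [intervalIntegral.integral_const_mul, intervalIntegral.integral_same, mul_zero,
    Real.exp_zero] at h
  rw [le_div_iff₀ hK]
  linarith

/-- The Volterra equation `p = 1 - lam ∫_0^x s ∫_0^t m p` has a global solution: for
`S(x) = ∫_0^x s` and `K` large, the equation for `u = e^{-K S} p` is a fixed point equation for a
contraction of the bounded continuous functions. -/
theorem exists_volterra {m s : ℝ → ℝ} {lam : ℝ} (hlam : 0 ≤ lam) (hmi : Integrable m)
    (hm0 : ∀ x, 0 ≤ m x) (hsi : ∀ a b, IntervalIntegrable s volume a b) (hs0 : ∀ x, 0 ≤ s x)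
    (hsc : ContinuousOn s (Ioi 0)) (hsn : ∀ x ≤ 0, s x = 0) :
    ∃ p : ℝ → ℝ, Continuous p ∧
      ∀ x, p x = 1 - lam * ∫ t in (0 : ℝ)..x, s t * ∫ r in (0 : ℝ)..t, m r * p r := by
  set M := ∫ x, m x
  have hM : 0 ≤ M := integral_nonneg hm0
  set K := 2 * lam * M + 1 with hKdef
  have hK : 0 < K := by positivity
  set w : ℝ → ℝ := fun x => Real.exp (K * ∫ r in (0 : ℝ)..x, s r) with hw
  have hS : Continuous fun t => ∫ r in (0 : ℝ)..t, s r :=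
    intervalIntegral.continuous_primitive hsi 0
  have hwc : Continuous w := by fun_prop
  have hw0 : ∀ x, 0 < w x := fun x => Real.exp_pos _
  have hwmono : ∀ x y, 0 ≤ x → x ≤ y → w x ≤ w y := by
    intro x y hx hxy
    refine Real.exp_le_exp.2 (mul_le_mul_of_nonneg_left ?_ hK.le)
    exact intervalIntegral.integral_mono_interval le_rfl hx hxy
      (ae_of_all _ fun t => hs0 t) (hsi 0 y)
  -- Integrals of `s` against anything vanish on the negative half-line.
  have hneg : ∀ (v : ℝ → ℝ) (x : ℝ), x ≤ 0 → ∫ t in (0 : ℝ)..x, s t * v t = 0 := by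
    intro v x hx
    have : ∫ t in (0 : ℝ)..x, s t * v t = ∫ t in (0 : ℝ)..x, (0 : ℝ) := by
      refine intervalIntegral.integral_congr fun t ht => ?_
      rw [uIcc_of_ge hx] at ht
      simp only [hsn t ht.2, zero_mul]
    rw [this]
    simp
  have hw1 : ∀ x, 1 ≤ w x := by
    intro x
    rcases le_total x 0 with h | h
    · have := hneg (fun _ => 1) x h
      simp only [mul_one] at this
      simp [hw, this]
    · have := hwmono 0 x le_rfl h
      simpa [hw] using this
  have hmint : ∀ (u : ℝ →ᵇ ℝ) (a b : ℝ), IntervalIntegrable (fun r => m r * (w r * u r)) volume a b :=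
    fun u a b => hmi.intervalIntegrable.mul_continuousOn (hwc.mul u.continuous).continuousOn
  have hGc : ∀ u : ℝ →ᵇ ℝ, Continuous fun t => ∫ r in (0 : ℝ)..t, m r * (w r * u r) := fun u =>
    intervalIntegral.continuous_primitive (hmint u) 0
  have hsG : ∀ (u : ℝ →ᵇ ℝ) (a b : ℝ),
      IntervalIntegrable (fun t => s t * ∫ r in (0 : ℝ)..t, m r * (w r * u r)) volume a b :=
    fun u a b => (hsi a b).mul_continuousOn (hGc u).continuousOn
  have hTc : ∀ u : ℝ →ᵇ ℝ,
      Continuous fun x => ∫ t in (0 : ℝ)..x, s t * ∫ r in (0 : ℝ)..t, m r * (w r * u r) := fun u =>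
    intervalIntegral.continuous_primitive (hsG u) 0
  have hGb : ∀ (u : ℝ →ᵇ ℝ) (t : ℝ), 0 ≤ t →
      |∫ r in (0 : ℝ)..t, m r * (w r * u r)| ≤ M * ‖u‖ * w t := by
    intro u t ht
    have h1 : ‖∫ r in (0 : ℝ)..t, m r * (w r * u r)‖ ≤ ∫ r in (0 : ℝ)..t, m r * (w t * ‖u‖) := by
      refine intervalIntegral.norm_integral_le_of_norm_le ht (ae_of_all _ fun r hr => ?_)
        (hmi.intervalIntegrable.mul_const _)
      rw [norm_mul, norm_mul, Real.norm_of_nonneg (hm0 r), Real.norm_of_nonneg (hw0 r).le]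
      exact mul_le_mul_of_nonneg_left (mul_le_mul (hwmono r t hr.1.le hr.2) (u.norm_coe_le_norm r)
        (norm_nonneg _) (hw0 t).le) (hm0 r)
    have h2 : ∫ r in (0 : ℝ)..t, m r ≤ M := by
      rw [intervalIntegral.integral_of_le ht]
      exact setIntegral_le_integral hmi (ae_of_all _ hm0)
    rw [intervalIntegral.integral_mul_const] at h1
    have h3 := mul_le_mul_of_nonneg_right h2 (mul_nonneg (hw0 t).le (norm_nonneg u))
    calc _ ≤ _ := h1
      _ ≤ _ := h3
      _ = _ := by ring
  have hTb : ∀ (u : ℝ →ᵇ ℝ) (x : ℝ),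
      |∫ t in (0 : ℝ)..x, s t * ∫ r in (0 : ℝ)..t, m r * (w r * u r)| ≤ M * ‖u‖ * (w x / K) := by
    intro u x
    rcases le_total x 0 with h | h
    · rw [hneg _ x h, abs_zero]
      have := hw0 x
      positivity
    · have h1 : ‖∫ t in (0 : ℝ)..x, s t * ∫ r in (0 : ℝ)..t, m r * (w r * u r)‖ ≤
          ∫ t in (0 : ℝ)..x, M * ‖u‖ * (s t * w t) := by
        refine intervalIntegral.norm_integral_le_of_norm_le h (ae_of_all _ fun t ht => ?_)
          (((hsi 0 x).mul_continuousOn hwc.continuousOn).const_mul _)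
        rw [norm_mul, Real.norm_of_nonneg (hs0 t), Real.norm_eq_abs]
        calc _ ≤ s t * (M * ‖u‖ * w t) := mul_le_mul_of_nonneg_left (hGb u t ht.1.le) (hs0 t)
          _ = _ := by ring
      rw [intervalIntegral.integral_const_mul] at h1
      exact h1.trans (mul_le_mul_of_nonneg_left (integral_mul_exp_primitive_le hsi hsc hK h)
        (by positivity))
  let Φ : (ℝ →ᵇ ℝ) → (ℝ →ᵇ ℝ) := fun u => BoundedContinuousFunction.ofNormedAddCommGroup
    (fun x => (1 - lam * ∫ t in (0 : ℝ)..x, s t * ∫ r in (0 : ℝ)..t, m r * (w r * u r)) / w x)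
    ((continuous_const.sub (continuous_const.mul (hTc u))).div hwc fun x => (hw0 x).ne')
    (1 + lam * (M * ‖u‖ / K)) (fun x => by
      rw [norm_div, Real.norm_of_nonneg (hw0 x).le, div_le_iff₀ (hw0 x)]
      refine (norm_sub_le _ _).trans ?_
      rw [norm_one, norm_mul, Real.norm_of_nonneg hlam, Real.norm_eq_abs]
      have h1 := mul_le_mul_of_nonneg_left (hTb u x) hlam
      have h2 := hw1 x
      calc _ ≤ w x + lam * (M * ‖u‖ * (w x / K)) := add_le_add h2 h1
        _ = _ := by ring)
  have hΦ : ContractingWith (1 / 2 : NNReal) Φ := by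
    refine ⟨by
      rw [← NNReal.coe_lt_coe]
      norm_num, LipschitzWith.of_dist_le_mul fun u v => ?_⟩
    rw [BoundedContinuousFunction.dist_le (by positivity)]
    intro x
    have hsub : (∫ t in (0 : ℝ)..x, s t * ∫ r in (0 : ℝ)..t, m r * (w r * u r)) -
        (∫ t in (0 : ℝ)..x, s t * ∫ r in (0 : ℝ)..t, m r * (w r * v r)) =
        ∫ t in (0 : ℝ)..x, s t * ∫ r in (0 : ℝ)..t, m r * (w r * (u - v) r) := by
      rw [← intervalIntegral.integral_sub (hsG u 0 x) (hsG v 0 x)]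
      refine intervalIntegral.integral_congr fun t _ => ?_
      rw [← mul_sub, ← intervalIntegral.integral_sub (hmint u 0 t) (hmint v 0 t)]
      congr 1
      refine intervalIntegral.integral_congr fun r _ => ?_
      simp only [BoundedContinuousFunction.coe_sub, Pi.sub_apply]
      ring
    have hd : Φ u x - Φ v x =
        -(lam * ∫ t in (0 : ℝ)..x, s t * ∫ r in (0 : ℝ)..t, m r * (w r * (u - v) r)) / w x := by
      rw [← hsub]
      change (1 - lam * _) / w x - (1 - lam * _) / w x = _
      ring
    rw [Real.dist_eq, hd, abs_div, abs_neg, abs_mul, abs_of_nonneg hlam, abs_of_pos (hw0 x),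
      div_le_iff₀ (hw0 x), dist_eq_norm]
    have h1 := mul_le_mul_of_nonneg_left (hTb (u - v) x) hlam
    refine h1.trans ?_
    have h2 : lam * M / K ≤ 1 / 2 := by
      rw [div_le_iff₀ hK, hKdef]
      linarith
    have h3 : 0 ≤ ‖u - v‖ * w x := mul_nonneg (norm_nonneg _) (hw0 x).le
    calc lam * (M * ‖u - v‖ * (w x / K)) = lam * M / K * (‖u - v‖ * w x) := by ring
      _ ≤ 1 / 2 * (‖u - v‖ * w x) := mul_le_mul_of_nonneg_right h2 h3
      _ = _ := by
        push_cast
        ring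
  set u := ContractingWith.fixedPoint Φ hΦ
  have hfix : Φ u = u := hΦ.fixedPoint_isFixedPt
  refine ⟨fun x => w x * u x, hwc.mul u.continuous, fun x => ?_⟩
  have h1 : u x = (1 - lam * ∫ t in (0 : ℝ)..x, s t * ∫ r in (0 : ℝ)..t, m r * (w r * u r)) / w x :=
    (congrArg (fun v : ℝ →ᵇ ℝ => v x) hfix).symm
  have h2 := (hw0 x).ne'
  rw [eq_div_iff h2] at h1
  simp only
  rw [mul_comm, h1]

/-- The solution of `g' = m p`, `p' = -lam s g` on `(0,∞)` with `g(0+) = 0` and `p(0+) = 1`. -/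
theorem exists_solution {m s : ℝ → ℝ} {lam : ℝ} (hlam : 0 ≤ lam)
    (hm : ContinuousOn m (Ioi 0)) (hm0 : ∀ x > 0, 0 < m x) (hmi : IntegrableOn m (Ioi 0))
    (hs : ContinuousOn s (Ioi 0)) (hs0 : ∀ x > 0, 0 < s x)
    (hsi : ∀ R, IntegrableOn s (Ioc 0 R)) :
    ∃ g p : ℝ → ℝ, Continuous g ∧ Continuous p ∧ g 0 = 0 ∧ p 0 = 1 ∧
      (∀ x > 0, HasDerivAt g (m x * p x) x) ∧
      ∀ x > 0, HasDerivAt p (-(lam * (s x * g x))) x := by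
  set m' := (Ioi (0 : ℝ)).indicator m with hm'
  set s' := (Ioi (0 : ℝ)).indicator s with hs'
  have em : EqOn m' m (Ioi 0) := eqOn_indicator
  have es : EqOn s' s (Ioi 0) := eqOn_indicator
  have hm'i : Integrable m' := (integrable_indicator_iff measurableSet_Ioi).2 hmi
  have hs'i : ∀ a b, IntervalIntegrable s' volume a b := by
    have h : ∀ a, IntervalIntegrable s' volume 0 a := by
      intro a
      rw [intervalIntegrable_iff, hs', IntegrableOn, integrable_indicator_iff measurableSet_Ioi,
        IntegrableOn, Measure.restrict_restrict measurableSet_Ioi]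
      refine (hsi a).mono_set fun x hx => ⟨hx.1, ?_⟩
      rcases mem_uIoc.1 hx.2 with h | h
      · exact h.2
      · exact absurd hx.1 (not_lt.2 h.2)
    exact fun a b => (h a).symm.trans (h b)
  have hs'c : ContinuousOn s' (Ioi 0) := hs.congr es
  obtain ⟨p, hpc, hp⟩ := exists_volterra hlam hm'i
    (fun x => indicator_nonneg (fun y hy => (hm0 y hy).le) x) hs'i
    (fun x => indicator_nonneg (fun y hy => (hs0 y hy).le) x) hs'c
    (fun x hx => indicator_of_notMem (notMem_Ioi.2 hx) s)
  have hmp : ∀ a b, IntervalIntegrable (fun r => m' r * p r) volume a b := fun a b =>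
    hm'i.intervalIntegrable.mul_continuousOn hpc.continuousOn
  have hgc : Continuous fun x => ∫ r in (0 : ℝ)..x, m' r * p r :=
    intervalIntegral.continuous_primitive hmp 0
  refine ⟨fun x => ∫ r in (0 : ℝ)..x, m' r * p r, p, hgc, hpc, intervalIntegral.integral_same,
    by rw [hp]; simp, fun x hx => ?_, fun x hx => ?_⟩
  · rw [← em hx]
    exact hasDerivAt_primitive (hmp 0) ((hm.congr em).mul hpc.continuousOn) hx
  · have h1 := ((hasDerivAt_primitive
      (fun y => (hs'i 0 y).mul_continuousOn hgc.continuousOn)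
      (hs'c.mul hgc.continuousOn) hx).const_mul lam).const_sub 1
    rw [← es hx]
    exact h1.congr_of_eventuallyEq (Eventually.of_forall hp)

/-! ### Positivity below the Dirichlet eigenvalue -/

/-- The energy `∫ g'² / m` of a solution of `g' = m p`, `p' = -lam s g`. -/
theorem integral_energy_solution {α β lam : ℝ} (hαβ : α ≤ β) {m s g p : ℝ → ℝ}
    (hm : ContinuousOn m (Icc α β)) (hs : ContinuousOn s (Icc α β))
    (hg : ∀ x ∈ Icc α β, HasDerivAt g (m x * p x) x)
    (hp : ∀ x ∈ Icc α β, HasDerivAt p (-(lam * (s x * g x))) x) :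
    ∫ x in α..β, m x * p x ^ 2 =
      p β * g β - p α * g α + lam * ∫ x in α..β, s x * g x ^ 2 := by
  have hgc : ContinuousOn g (Icc α β) := HasDerivAt.continuousOn hg
  have hpc : ContinuousOn p (Icc α β) := HasDerivAt.continuousOn hp
  have i1 : IntervalIntegrable (fun x => m x * p x ^ 2) volume α β :=
    (hm.mul (hpc.pow 2)).intervalIntegrable_of_Icc hαβ
  have i2 : IntervalIntegrable (fun x => lam * (s x * g x ^ 2)) volume α β :=
    ((hs.mul (hgc.pow 2)).intervalIntegrable_of_Icc hαβ).const_mul lam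
  have h := intervalIntegral.integral_eq_sub_of_hasDerivAt
    (f := fun x => p x * g x) (f' := fun x => m x * p x ^ 2 - lam * (s x * g x ^ 2))
    (a := α) (b := β)
    (fun x hx => by
      rw [uIcc_of_le hαβ] at hx
      exact ((hp x hx).mul (hg x hx)).congr_deriv (by ring)) (i1.sub i2)
  rw [intervalIntegral.integral_sub i1 i2, intervalIntegral.integral_const_mul] at h
  linarith

/-- The Rayleigh quotient of the truncation `(g - g(α))⁺` on `[α, β]`, extended by zero, for a
nonnegative `g` that vanishes at `β`. -/
theorem rayleigh_truncation {α β l : ℝ} (hα : 0 < α) (hαβ : α < β) (hl : 0 ≤ l) {m s g p : ℝ → ℝ}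
    (hm : ContinuousOn m (Ioi 0)) (hm0 : ∀ x > 0, 0 < m x)
    (hs : ContinuousOn s (Ioi 0)) (hs0 : ∀ x > 0, 0 < s x) (hp : ContinuousOn p (Icc α β))
    (hg : ∀ x ∈ Icc α β, HasDerivAt g (m x * p x) x) (hg0 : ∀ x ∈ Icc α β, 0 ≤ g x)
    (hgβ : g β = 0) (hL : ENNReal.ofReal l ≤ lamDD s m) :
    l * ((∫ x in α..β, s x * g x ^ 2) - 2 * g α * ∫ x in α..β, s x * g x) ≤
      ∫ x in α..β, m x * p x ^ 2 := by
  have hsub : Icc α β ⊆ Ioi 0 := fun x hx => hα.trans_le hx.1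
  have hgα := hg0 α (left_mem_Icc.2 hαβ.le)
  have hgc : ContinuousOn g (Icc α β) := HasDerivAt.continuousOn hg
  have hmpc : ContinuousOn (fun x => m x * p x) (Icc α β) := (hm.mono hsub).mul hp
  set κ : ℝ → ℝ := fun x => max α (min x β) with hκ
  have hκmem : ∀ x, κ x ∈ Icc α β := fun x =>
    ⟨le_max_left _ _, max_le hαβ.le (min_le_right _ _)⟩
  have hκid : ∀ x ∈ Icc α β, κ x = x := fun x hx => by
    simp only [hκ, min_eq_left hx.2, max_eq_right hx.1]
  set φ : ℝ → ℝ := fun x => max (g (κ x) - g α) 0 with hφ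
  have hφ0 : ∀ x, 0 ≤ φ x := fun x => le_max_right _ _
  have hφout : ∀ x, x ∉ Ioo α β → φ x = 0 := by
    intro x hx
    rcases le_or_gt x α with h | h
    · have : κ x = α := by simp only [hκ, min_eq_left (h.trans hαβ.le), max_eq_left h]
      simp only [hφ, this, sub_self, max_self]
    · have h' : β ≤ x := not_lt.1 fun h' => hx ⟨h, h'⟩
      have : κ x = β := by simp only [hκ, min_eq_right h', max_eq_right hαβ.le]
      simp only [hφ, this, hgβ]
      exact max_eq_right (by linarith)
  have hφlip : ∃ K, LipschitzWith K φ := by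
    obtain ⟨K, hK⟩ := isCompact_Icc.exists_bound_of_continuousOn hmpc
    have h1 : LipschitzOnWith K.toNNReal g (Icc α β) :=
      (convex_Icc α β).lipschitzOnWith_of_nnnorm_hasDerivWithin_le
        (fun z hz => (hg z hz).hasDerivWithinAt) fun z hz => by
          rw [← NNReal.coe_le_coe]
          exact (hK z hz).trans (Real.le_coe_toNNReal K)
    have h2 : LipschitzWith 1 κ := (LipschitzWith.id.min_const β).const_max α
    have h3 : LipschitzWith (K.toNNReal * 1) (g ∘ κ) :=
      lipschitzOnWith_univ.1 (h1.comp (lipschitzOnWith_univ.2 h2) fun x _ => hκmem x)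
    have h4 : LipschitzWith (K.toNNReal * 1) fun x => g (κ x) - g α :=
      LipschitzWith.of_dist_le_mul fun x y => by
        rw [dist_sub_right]
        exact h3.dist_le_mul x y
    exact ⟨_, h4.max_const 0⟩
  obtain ⟨K, hφK⟩ := hφlip
  have hφac : LocAbsCont φ := fun x y _ _ => hφK.lipschitzOnWith.absolutelyContinuousOnInterval
  have hsupp : Function.support φ ⊆ Icc α β := fun x hx =>
    by_contra fun h => hx (hφout x fun h' => h (Ioo_subset_Icc_self h'))
  have hφcs : HasCompactSupport φ := HasCompactSupport.of_support_subset_isCompact isCompact_Icc hsupp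
  have hφts : tsupport φ ⊆ Ioi 0 := (closure_minimal hsupp isClosed_Icc).trans hsub
  -- Where `φ` vanishes it has a minimum; elsewhere it is locally `g - g α`.
  have hderiv : ∀ x, deriv φ x = 0 ∨ (x ∈ Ioo α β ∧ deriv φ x = m x * p x) := by
    intro x
    rcases (hφ0 x).eq_or_lt with h | h
    · left
      exact IsLocalMin.deriv_eq_zero (Eventually.of_forall fun y => h ▸ hφ0 y)
    · right
      have hx : x ∈ Ioo α β := by_contra fun hx => h.ne' (hφout x hx)
      refine ⟨hx, ?_⟩
      have h1 : ∀ᶠ y in 𝓝 x, φ y = g y - g α := by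
        filter_upwards [hφK.continuous.continuousAt.eventually (lt_mem_nhds h),
          isOpen_Ioo.mem_nhds hx] with y hy hy'
        have h2 : φ y = max (g y - g α) 0 := by
          simp only [hφ, hκid y (Ioo_subset_Icc_self hy')]
        rw [h2] at hy ⊢
        exact max_eq_left (le_of_lt ((lt_max_iff.1 hy).resolve_right (lt_irrefl 0)))
      rw [EventuallyEq.deriv_eq h1]
      exact ((hg x (Ioo_subset_Icc_self hx)).sub_const _).deriv
  have hIoc : Ioc α β ⊆ Ioi 0 := Ioc_subset_Icc_self.trans hsub
  have hmp2 : IntegrableOn (fun x => m x * p x ^ 2) (Ioc α β) :=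
    (((hm.mono hsub).mul (hp.pow 2)).integrableOn_Icc).mono_set Ioc_subset_Icc_self
  have hE : energy m φ ≤ ENNReal.ofReal (∫ x in α..β, m x * p x ^ 2) := by
    rw [intervalIntegral.integral_of_le hαβ.le, ofReal_integral_eq_lintegral_ofReal hmp2
      ((ae_restrict_iff' measurableSet_Ioc).2 (ae_of_all _ fun x hx =>
        mul_nonneg (hm0 x (hIoc hx)).le (sq_nonneg _))), energy,
      ← lintegral_indicator measurableSet_Ioc]
    refine (setLIntegral_mono' measurableSet_Ioi fun x hx => ?_).trans
      (setLIntegral_le_lintegral (Ioi 0) _)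
    rcases hderiv x with h | ⟨h, h'⟩
    · simp [h]
    · rw [indicator_of_mem (Ioo_subset_Ioc_self h), h']
      refine ENNReal.ofReal_le_ofReal (le_of_eq ?_)
      have := hm0 x hx
      field_simp
  have hsφ : IntegrableOn (fun x => s x * φ x ^ 2) (Ioc α β) :=
    (((hs.mono hsub).mul (hφK.continuous.continuousOn.pow 2)).integrableOn_Icc).mono_set
      Ioc_subset_Icc_self
  have hsφ0 : ∀ x ∈ Ioi 0 \ Ioc α β, s x * φ x ^ 2 = 0 := fun x hx => by
    rw [hφout x fun h => hx.2 (Ioo_subset_Ioc_self h)]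
    ring
  have hsφ' : IntegrableOn (fun x => s x * φ x ^ 2) (Ioi 0) :=
    hsφ.of_forall_sdiff_eq_zero measurableSet_Ioi hsφ0
  have hN := normSq_eq_ofReal hs hs0 hsφ'
  rw [setIntegral_eq_of_subset_of_forall_sdiff_eq_zero measurableSet_Ioi hIoc hsφ0,
    ← intervalIntegral.integral_of_le hαβ.le] at hN
  have hR := lamDD_mul_normSq_le (m := s) (s := m) hφac hφcs hφts
    (by rw [hN]; exact ENNReal.ofReal_ne_top)
  have hR' : ENNReal.ofReal (l * ∫ x in α..β, s x * φ x ^ 2) ≤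
      ENNReal.ofReal (∫ x in α..β, m x * p x ^ 2) := by
    rw [ENNReal.ofReal_mul hl]
    refine le_trans ?_ (hR.trans hE)
    rw [hN]
    gcongr
  rw [ENNReal.ofReal_le_ofReal_iff (intervalIntegral.integral_nonneg hαβ.le fun x hx =>
    mul_nonneg (hm0 x (hsub hx)).le (sq_nonneg _))] at hR'
  refine le_trans (mul_le_mul_of_nonneg_left ?_ hl) hR'
  have j1 : IntervalIntegrable (fun x => s x * g x ^ 2) volume α β :=
    ((hs.mono hsub).mul (hgc.pow 2)).intervalIntegrable_of_Icc hαβ.le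
  have j2 : IntervalIntegrable (fun x => 2 * g α * (s x * g x)) volume α β :=
    (((hs.mono hsub).mul hgc).intervalIntegrable_of_Icc hαβ.le).const_mul _
  rw [← intervalIntegral.integral_const_mul, ← intervalIntegral.integral_sub j1 j2]
  refine intervalIntegral.integral_mono_on hαβ.le (j1.sub j2)
    ((intervalIntegrable_iff_integrableOn_Ioc_of_le hαβ.le).2 hsφ) fun x hx => ?_
  have h1 : φ x = max (g x - g α) 0 := by simp only [hφ, hκid x hx]
  have h2 : g x ^ 2 - 2 * g α * g x ≤ φ x ^ 2 := by
    rw [h1]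
    rcases le_total (g x) (g α) with h | h
    · rw [max_eq_right (by linarith)]
      nlinarith [hg0 x hx]
    · rw [max_eq_left (by linarith)]
      nlinarith
  have := mul_le_mul_of_nonneg_left h2 (hs0 x (hsub hx)).le
  linarith

/-- Below the Dirichlet eigenvalue the solution started at `0` stays positive: at its first zero
`β`, the truncations `(g - g(α))⁺` on `[α, β]` with `α → 0` would be test functions with Rayleigh
quotients tending to `lam`. -/
theorem solution_pos {lam : ℝ} (hlam : 0 ≤ lam) {m s g p : ℝ → ℝ}
    (hm : ContinuousOn m (Ioi 0)) (hm0 : ∀ x > 0, 0 < m x)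
    (hs : ContinuousOn s (Ioi 0)) (hs0 : ∀ x > 0, 0 < s x)
    (hgc : Continuous g) (hpc : Continuous p) (hg0 : g 0 = 0) (hp0 : p 0 = 1)
    (hg : ∀ x > 0, HasDerivAt g (m x * p x) x)
    (hp : ∀ x > 0, HasDerivAt p (-(lam * (s x * g x))) x)
    (hL : lam = 0 ∨ ENNReal.ofReal lam < lamDD s m) :
    ∀ x > 0, 0 < g x := by
  obtain ⟨δ, hδ, hpδ⟩ : ∃ δ > 0, ∀ x ∈ Icc 0 δ, 0 < p x := by
    have h : ∀ᶠ x in 𝓝 0, 0 < p x := hpc.continuousAt.eventually (lt_mem_nhds (by simp [hp0]))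
    obtain ⟨ε, hε, h⟩ := Metric.eventually_nhds_iff.1 h
    refine ⟨ε / 2, by positivity, fun x hx => h ?_⟩
    rw [Real.dist_eq, sub_zero, abs_of_nonneg hx.1]
    linarith [hx.2]
  have hgδ : ∀ x ∈ Ioc 0 δ, 0 < g x := by
    have hmono : StrictMonoOn g (Icc 0 δ) :=
      strictMonoOn_of_deriv_pos (convex_Icc 0 δ) hgc.continuousOn fun x hx => by
        rw [interior_Icc] at hx
        rw [(hg x hx.1).deriv]
        exact mul_pos (hm0 x hx.1) (hpδ x (Ioo_subset_Icc_self hx))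
    intro x hx
    have := hmono (left_mem_Icc.2 hδ.le) (Ioc_subset_Icc_self hx) hx.1
    rwa [hg0] at this
  by_contra! hneg
  obtain ⟨x₁, hx₁, hgx₁⟩ := hneg
  have hδx₁ : δ < x₁ := not_le.1 fun h => not_lt.2 hgx₁ (hgδ x₁ ⟨hx₁, h⟩)
  -- `β` is the first zero of `g`
  obtain ⟨β, ⟨hβmem, hgβ⟩, hβmin⟩ :=
    (isCompact_Icc.inter_right (isClosed_eq hgc continuous_const :
      IsClosed {x | g x = 0})).exists_isLeast (s := Icc δ x₁ ∩ {x | g x = 0}) (by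
        obtain ⟨z, hz, hz'⟩ := intermediate_value_Icc' hδx₁.le hgc.continuousOn
          ⟨hgx₁, (hgδ δ (right_mem_Ioc.2 hδ)).le⟩
        exact ⟨z, hz, hz'⟩)
  have hgβ : g β = 0 := hgβ
  have hδβ : δ < β := lt_of_le_of_ne hβmem.1 fun h =>
    (hgδ δ (right_mem_Ioc.2 hδ)).ne' (h ▸ hgβ)
  have hgnn : ∀ x ∈ Icc 0 β, 0 ≤ g x := by
    intro x hx
    by_contra! h
    have hδx : δ < x := by
      by_contra! h'
      rcases hx.1.eq_or_lt with h0 | h0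
      · rw [← h0, hg0] at h
        exact lt_irrefl _ h
      · exact absurd (hgδ x ⟨h0, h'⟩) (not_lt.2 h.le)
    obtain ⟨z, hz, hz'⟩ := intermediate_value_Icc' hδx.le hgc.continuousOn
      ⟨h.le, (hgδ δ (right_mem_Ioc.2 hδ)).le⟩
    have h1 : β ≤ z := hβmin ⟨⟨hz.1, hz.2.trans (hx.2.trans hβmem.2)⟩, hz'⟩
    have h2 : x = β := le_antisymm hx.2 (h1.trans hz.2)
    rw [h2, hgβ] at h
    exact lt_irrefl _ h
  have hsubα : ∀ α > 0, Icc α β ⊆ Ioi 0 := fun α hα x hx => hα.trans_le hx.1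
  have hident : ∀ α ∈ Ioc 0 δ, ∫ x in α..β, m x * p x ^ 2 =
      -(p α * g α) + lam * ∫ x in α..β, s x * g x ^ 2 := fun α hα => by
    have := integral_energy_solution (lam := lam) (hα.2.trans hδβ.le)
      (hm.mono (hsubα α hα.1)) (hs.mono (hsubα α hα.1)) (fun x hx => hg x (hsubα α hα.1 hx))
      (fun x hx => hp x (hsubα α hα.1 hx))
    rw [hgβ] at this
    linarith
  have hδmem : δ ∈ Ioc 0 δ := right_mem_Ioc.2 hδ
  have hpgδ : ∀ α ∈ Ioc 0 δ, 0 < p α * g α := fun α hα =>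
    mul_pos (hpδ α ⟨hα.1.le, hα.2⟩) (hgδ α hα)
  have hIpos : 0 < lam * ∫ x in δ..β, s x * g x ^ 2 := by
    have h1 := hident δ hδmem
    have h2 : 0 ≤ ∫ x in δ..β, m x * p x ^ 2 :=
      intervalIntegral.integral_nonneg hδβ.le fun x hx =>
        mul_nonneg (hm0 x (hsubα δ hδ hx)).le (sq_nonneg _)
    have h3 := hpgδ δ hδmem
    linarith
  -- For `lam = 0` the energy on `[δ, β]` would be negative.
  rcases hlam.eq_or_lt with rfl | hlam
  · simp at hIpos
  replace hL := hL.resolve_left hlam.ne'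
  obtain ⟨l, hl0, hl, hl'⟩ := ENNReal.lt_iff_exists_real_btwn.1 hL
  have hll : lam < l := (ENNReal.ofReal_lt_ofReal_iff_of_nonneg hlam.le).1 hl
  have hsi : ∀ {v : ℝ → ℝ}, Continuous v → ∀ α > 0, α ≤ β →
      IntervalIntegrable (fun x => s x * v x) volume α β := fun hv α hα hαβ =>
    ((hs.mono (hsubα α hα)).mul hv.continuousOn).intervalIntegrable_of_Icc hαβ
  set I := ∫ x in δ..β, s x * g x ^ 2
  replace hIpos : 0 < I := pos_of_mul_pos_right hIpos hlam.le
  have key : ∀ α ∈ Ioc 0 δ, (l - lam) * I ≤ 2 * l * g α * ((p α - p β) / lam) := by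
    intro α hα
    have hαβ : α < β := hα.2.trans_lt hδβ
    have h1 := rayleigh_truncation hα.1 hαβ hl0 hm hm0 hs hs0 hpc.continuousOn
      (fun x hx => hg x (hsubα α hα.1 hx))
      (fun x hx => hgnn x ⟨hα.1.le.trans hx.1, hx.2⟩) hgβ hl'.le
    rw [hident α hα] at h1
    have h2 := hpgδ α hα
    have h3 : I ≤ ∫ x in α..β, s x * g x ^ 2 := by
      refine intervalIntegral.integral_mono_interval hα.2 hδβ.le le_rfl ?_
        (hsi (hgc.pow 2) α hα.1 hαβ.le)
      exact (ae_restrict_iff' measurableSet_Ioc).2 (ae_of_all _ fun x hx =>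
        mul_nonneg (hs0 x (hα.1.trans hx.1)).le (sq_nonneg _))
    have h4 : ∫ x in α..β, s x * g x = (p α - p β) / lam := by
      have h5 := intervalIntegral.integral_eq_sub_of_hasDerivAt (a := α) (b := β)
        (fun x hx => hp x (hsubα α hα.1 (uIcc_of_le hαβ.le ▸ hx)))
        (((hsi hgc α hα.1 hαβ.le).const_mul lam).neg)
      rw [intervalIntegral.integral_neg, intervalIntegral.integral_const_mul] at h5
      rw [eq_div_iff hlam.ne']
      linarith
    rw [h4] at h1
    have h6 := mul_le_mul_of_nonneg_left h3 (sub_nonneg.2 hll.le)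
    nlinarith
  have hlim : Tendsto (fun α => 2 * l * g α * ((p α - p β) / lam)) (𝓝[>] 0) (𝓝 0) := by
    have : Continuous fun α => 2 * l * g α * ((p α - p β) / lam) := by fun_prop
    have h := this.tendsto 0
    simp only [hg0, mul_zero, zero_mul] at h
    exact h.mono_left nhdsWithin_le_nhds
  have := ge_of_tendsto hlim (by
    filter_upwards [Ioc_mem_nhdsGT hδ] with α hα using key α hα)
  have h7 := mul_pos (sub_pos.2 hll) hIpos
  linarith

/-! ### Regularity of the coefficients -/

theorem contDiffOn_succ_of_hasDerivAt {f f' : ℝ → ℝ} {n : ℕ}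
    (hf : ∀ x > 0, HasDerivAt f (f' x) x) (hf' : ContDiffOn ℝ n f' (Ioi 0)) :
    ContDiffOn ℝ ((n : WithTop ℕ∞) + 1) f (Ioi 0) := by
  rw [contDiffOn_succ_iff_deriv_of_isOpen isOpen_Ioi]
  exact ⟨fun x hx => (hf x hx).differentiableAt.differentiableWithinAt, by simp,
    hf'.congr fun x hx => (hf x hx).deriv⟩

theorem contDiffOn_two_of_hasDerivAt {f f' : ℝ → ℝ}
    (hf : ∀ x > 0, HasDerivAt f (f' x) x) (hf' : ContDiffOn ℝ 1 f' (Ioi 0)) :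
    ContDiffOn ℝ 2 f (Ioi 0) := by
  have := contDiffOn_succ_of_hasDerivAt (n := 1) hf (by exact_mod_cast hf')
  convert this using 1
  norm_num

theorem contDiffOn_one_of_hasDerivAt {f f' : ℝ → ℝ}
    (hf : ∀ x > 0, HasDerivAt f (f' x) x) (hf' : ContinuousOn f' (Ioi 0)) :
    ContDiffOn ℝ 1 f (Ioi 0) := by
  have := contDiffOn_succ_of_hasDerivAt (n := 0) hf (by simpa using (contDiffOn_zero (𝕜 := ℝ)).2 hf')
  simpa using this

section Coefficients

variable {a b : ℝ → ℝ} {θ : ℝ}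

theorem hasDerivAt_logWeight (hθ : 0 < θ) (ha : ContDiffOn ℝ 1 a (Ioi 0))
    (hb : ContDiffOn ℝ 1 b (Ioi 0)) (ha_pos : ∀ x > 0, 0 < a x) {x : ℝ} (hx : 0 < x) :
    HasDerivAt (logWeight a b θ) (b x / a x) x := by
  have hc : ContinuousOn (fun x => b x / a x) (Ioi 0) :=
    hb.continuousOn.div ha.continuousOn fun x hx => (ha_pos x hx).ne'
  exact intervalIntegral.integral_hasDerivAt_right
    (hc.mono fun y hy => lt_of_lt_of_le (lt_min hθ hx) hy.1).intervalIntegrable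
    (hc.stronglyMeasurableAtFilter isOpen_Ioi x hx) (hc.continuousAt (Ioi_mem_nhds hx))

theorem contDiffOn_logWeight (hθ : 0 < θ) (ha : ContDiffOn ℝ 1 a (Ioi 0))
    (hb : ContDiffOn ℝ 1 b (Ioi 0)) (ha_pos : ∀ x > 0, 0 < a x) :
    ContDiffOn ℝ 2 (logWeight a b θ) (Ioi 0) :=
  contDiffOn_two_of_hasDerivAt (fun _ hx => hasDerivAt_logWeight hθ ha hb ha_pos hx)
    (hb.div ha fun x hx => (ha_pos x hx).ne')

theorem scaleDensity_pos (a b : ℝ → ℝ) (θ x : ℝ) : 0 < scaleDensity a b θ x := Real.exp_pos _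

theorem speedDensity_pos (ha_pos : ∀ x > 0, 0 < a x) (b : ℝ → ℝ) (θ : ℝ) :
    ∀ x > 0, 0 < speedDensity a b θ x := fun x hx => div_pos (Real.exp_pos _) (ha_pos x hx)

theorem contDiffOn_scaleDensity (hθ : 0 < θ) (ha : ContDiffOn ℝ 1 a (Ioi 0))
    (hb : ContDiffOn ℝ 1 b (Ioi 0)) (ha_pos : ∀ x > 0, 0 < a x) :
    ContDiffOn ℝ 2 (scaleDensity a b θ) (Ioi 0) :=
  (contDiffOn_logWeight hθ ha hb ha_pos).neg.exp

theorem contDiffOn_speedDensity (hθ : 0 < θ) (ha : ContDiffOn ℝ 1 a (Ioi 0))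
    (hb : ContDiffOn ℝ 1 b (Ioi 0)) (ha_pos : ∀ x > 0, 0 < a x) :
    ContDiffOn ℝ 1 (speedDensity a b θ) (Ioi 0) :=
  ((contDiffOn_logWeight hθ ha hb ha_pos).of_le one_le_two).exp.div ha
    fun x hx => (ha_pos x hx).ne'

theorem hasDerivAt_scaleDensity (hθ : 0 < θ) (ha : ContDiffOn ℝ 1 a (Ioi 0))
    (hb : ContDiffOn ℝ 1 b (Ioi 0)) (ha_pos : ∀ x > 0, 0 < a x) {x : ℝ} (hx : 0 < x) :
    HasDerivAt (scaleDensity a b θ) (-(b x / a x) * scaleDensity a b θ x) x :=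
  (hasDerivAt_logWeight hθ ha hb ha_pos hx).neg.exp.congr_deriv (mul_comm _ _)

/-- `m s = 1 / a`. -/
theorem speedDensity_mul_scaleDensity (a b : ℝ → ℝ) (θ x : ℝ) :
    speedDensity a b θ x * scaleDensity a b θ x = 1 / a x := by
  rw [speedDensity, scaleDensity, div_mul_eq_mul_div, ← Real.exp_add, add_neg_cancel, Real.exp_zero]

theorem integrableOn_of_halfLineMeasure_lt_top {m : ℝ → ℝ} (hm : ContinuousOn m (Ioi 0))
    (hm0 : ∀ x > 0, 0 < m x) (h : halfLineMeasure m univ < ⊤) : IntegrableOn m (Ioi 0) := by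
  rw [halfLineMeasure, withDensity_apply _ MeasurableSet.univ, Measure.restrict_univ] at h
  exact (lintegral_ofReal_ne_top_iff_integrable (hm.aestronglyMeasurable measurableSet_Ioi)
    ((ae_restrict_iff' measurableSet_Ioi).2 (ae_of_all _ fun x hx => (hm0 x hx).le))).1 h.ne

/-- A function which is continuous on `(0,∞)` and bounded near `0` is integrable on `(0,R]`. -/
theorem integrableOn_Ioc_of_bounded {s : ℝ → ℝ} (hs : ContinuousOn s (Ioi 0)) {K δ : ℝ}
    (hδ : 0 < δ) (hK : ∀ x ∈ Ioo 0 δ, ‖s x‖ ≤ K) (R : ℝ) : IntegrableOn s (Ioc 0 R) := by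
  have h1 : IntegrableOn s (Ioo 0 δ) :=
    IntegrableOn.of_bound (by simp)
      ((hs.mono Ioo_subset_Ioi_self).aestronglyMeasurable measurableSet_Ioo) K
      ((ae_restrict_iff' measurableSet_Ioo).2 (ae_of_all _ hK))
  have h2 : IntegrableOn s (Icc δ R) :=
    (hs.mono fun x hx => hδ.trans_le hx.1).integrableOn_Icc
  refine (h1.union h2).mono_set fun x hx => ?_
  rcases lt_or_ge x δ with h | h
  · exact Or.inl ⟨hx.1, h⟩
  · exact Or.inr ⟨h, hx.2⟩

/-- `L_S f = (a f' + b f)'`. -/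
theorem hasDerivAt_schrodingerOp (ha : ContDiffOn ℝ 1 a (Ioi 0)) (hb : ContDiffOn ℝ 1 b (Ioi 0))
    {f : ℝ → ℝ} (hf : ContDiffOn ℝ 2 f (Ioi 0)) {x : ℝ} (hx : 0 < x) :
    HasDerivAt (fun y => a y * deriv f y + b y * f y) (schrodingerOp a b f x) x := by
  have hn : Ioi 0 ∈ 𝓝 x := Ioi_mem_nhds hx
  have da := ((ha.differentiableOn one_ne_zero).differentiableAt hn).hasDerivAt
  have db := ((hb.differentiableOn one_ne_zero).differentiableAt hn).hasDerivAt
  have df := ((hf.differentiableOn two_ne_zero).differentiableAt hn).hasDerivAt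
  have hf' : ContDiffOn ℝ 1 (deriv f) (Ioi 0) :=
    hf.deriv_of_isOpen isOpen_Ioi (by norm_num)
  have ddf := ((hf'.differentiableOn one_ne_zero).differentiableAt hn).hasDerivAt
  refine ((da.mul ddf).add (db.mul df)).congr_deriv ?_
  rw [schrodingerOp]
  ring

/-! ### The variational formula -/

/-- For `f` in the test class, `g = f / s` and `p = a f' + b f` satisfy `g' = m p` and
`p' = L_S f`. -/
theorem lamS_le_lamOne (hθ : 0 < θ) (ha : ContDiffOn ℝ 1 a (Ioi 0))
    (hb : ContDiffOn ℝ 1 b (Ioi 0)) (ha_pos : ∀ x > 0, 0 < a x)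
    (hmi : IntegrableOn (speedDensity a b θ) (Ioi 0)) :
    lamS a b ≤ (lamOne a b θ : EReal) := by
  refine iSup₂_le fun f hf => ?_
  obtain ⟨hf2, -, hfpos⟩ := hf
  by_contra! hlt
  obtain ⟨r, hr, hr'⟩ := EReal.lt_iff_exists_real_btwn.1 hlt
  have hr0 : 0 < r := by
    have := (EReal.coe_ennreal_nonneg (lamOne a b θ)).trans_lt hr
    exact_mod_cast this
  refine absurd hr (not_lt.2 ?_)
  have hs0 := scaleDensity_pos a b θ
  have key : ENNReal.ofReal r ≤ lamOne a b θ := by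
    refine ofReal_le_lamNN_of_supersolution hr0 (g := fun x => f x / scaleDensity a b θ x)
      (p := fun y => a y * deriv f y + b y * f y) (q := schrodingerOp a b f)
      (contDiffOn_speedDensity hθ ha hb ha_pos).continuousOn (speedDensity_pos ha_pos b θ) hmi
      (contDiffOn_scaleDensity hθ ha hb ha_pos).continuousOn (fun x _ => hs0 x)
      (fun x hx => div_pos (hfpos x hx) (hs0 x)) (fun x hx => ?_)
      (fun x hx => hasDerivAt_schrodingerOp ha hb hf2 hx) (fun x hx => ?_)
    · have df := ((hf2.differentiableOn two_ne_zero).differentiableAt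
        (Ioi_mem_nhds hx)).hasDerivAt
      refine (df.div (hasDerivAt_scaleDensity hθ ha hb ha_pos hx) (hs0 x).ne').congr_deriv ?_
      have h1 := speedDensity_mul_scaleDensity a b θ x
      have h2 := (hs0 x).ne'
      have h3 := (ha_pos x hx).ne'
      rw [← eq_div_iff h2] at h1
      rw [h1]
      field_simp
      ring
    · rw [mul_div_cancel₀ _ (hs0 x).ne']
      have h1 : (r : EReal) ≤ ((-schrodingerOp a b f x / f x : ℝ) : EReal) :=
        hr'.le.trans (iInf₂_le x hx)
      rw [EReal.coe_le_coe_iff, le_div_iff₀ (hfpos x hx)] at h1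
      exact h1
  calc (r : EReal) = ((ENNReal.ofReal r : ℝ≥0∞) : EReal) := by
        rw [EReal.coe_ennreal_ofReal, max_eq_left hr0.le]
    _ ≤ _ := EReal.coe_ennreal_le_coe_ennreal_iff.2 key

/-- The solution `g` of `L^* g = -lam g` with `g(0+) = 0` yields the test function `f = s g`, for
which `-L_S f / f` is constantly `lam`. -/
theorem le_lamS_of_lt_lamDualDD (hθ : 0 < θ) (ha : ContDiffOn ℝ 1 a (Ioi 0))
    (hb : ContDiffOn ℝ 1 b (Ioi 0)) (ha_pos : ∀ x > 0, 0 < a x)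
    (hC : ∃ K : ℝ, ∃ δ > 0, ∀ x ∈ Ioo 0 δ, |logWeight a b θ x| ≤ K)
    (hmi : IntegrableOn (speedDensity a b θ) (Ioi 0)) {lam : ℝ} (hlam : 0 ≤ lam)
    (hL : lam = 0 ∨ ENNReal.ofReal lam < lamDualDD a b θ) :
    (lam : EReal) ≤ lamS a b := by
  have hm1 := contDiffOn_speedDensity hθ ha hb ha_pos
  have hm := hm1.continuousOn
  have hm0 := speedDensity_pos ha_pos b θ
  have hs2 := contDiffOn_scaleDensity hθ ha hb ha_pos
  have hs := hs2.continuousOn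
  have hs0 := scaleDensity_pos a b θ
  set m := speedDensity a b θ
  set s := scaleDensity a b θ
  obtain ⟨K, δ, hδ, hK⟩ := hC
  have hsK : ∀ x ∈ Ioo 0 δ, ‖s x‖ ≤ Real.exp K := fun x hx => by
    rw [Real.norm_of_nonneg (hs0 x).le]
    exact Real.exp_le_exp.2 ((neg_le_abs _).trans (hK x hx))
  obtain ⟨g, p, hgc, hpc, hg0, hp0, hg, hp⟩ := exists_solution hlam hm hm0 hmi hs
    (fun x _ => hs0 x) (integrableOn_Ioc_of_bounded hs hδ hsK)
  have hgpos := solution_pos hlam hm hm0 hs (fun x _ => hs0 x) hgc hpc hg0 hp0 hg hp hL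
  have hp1 : ContDiffOn ℝ 1 p (Ioi 0) := contDiffOn_one_of_hasDerivAt hp
    (continuousOn_const.mul (hs.mul hgc.continuousOn)).neg
  have hg2 : ContDiffOn ℝ 2 g (Ioi 0) := contDiffOn_two_of_hasDerivAt hg (hm1.mul hp1)
  set f : ℝ → ℝ := fun x => s x * g x with hf
  have hf2 : ContDiffOn ℝ 2 f (Ioi 0) := hs2.mul hg2
  have hfpos : ∀ x > 0, 0 < f x := fun x hx => mul_pos (hs0 x) (hgpos x hx)
  have hflim : Tendsto f (𝓝[>] 0) (𝓝 0) := by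
    have h1 : Tendsto (fun x => Real.exp K * ‖g x‖) (𝓝[>] 0) (𝓝 0) := by
      have h2 : Continuous fun x => Real.exp K * ‖g x‖ := by fun_prop
      have h3 := h2.tendsto 0
      simp only [hg0, norm_zero, mul_zero] at h3
      exact h3.mono_left nhdsWithin_le_nhds
    refine squeeze_zero_norm' ?_ h1
    filter_upwards [Ioo_mem_nhdsGT hδ] with x hx
    rw [hf, norm_mul]
    exact mul_le_mul_of_nonneg_right (hsK x hx) (norm_nonneg _)
  have hLS : ∀ x > 0, schrodingerOp a b f x = -(lam * f x) := by
    intro x hx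
    refine HasDerivAt.unique (hasDerivAt_schrodingerOp ha hb hf2 hx)
      ((hp x hx).congr_of_eventuallyEq ?_)
    filter_upwards [Ioi_mem_nhds hx] with y hy
    have hy : 0 < y := hy
    have h1 := speedDensity_mul_scaleDensity a b θ y
    have h2 := (ha_pos y hy).ne'
    have hfd : HasDerivAt f (-(b y / a y) * s y * g y + s y * (m y * p y)) y :=
      (hasDerivAt_scaleDensity hθ ha hb ha_pos hy).mul (hg y hy)
    rw [hfd.deriv]
    change a y * (-(b y / a y) * s y * g y + s y * (m y * p y)) + b y * (s y * g y) = p y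
    have h3 : s y * (m y * p y) = p y / a y := by
      rw [← mul_assoc, mul_comm (s y), h1, one_div_mul_eq_div]
    rw [h3]
    field_simp
    ring
  refine le_trans ?_ (le_iSup₂ (f := fun f (_ : f ∈ testClass) =>
    ⨅ x ∈ Ioi (0 : ℝ), ((-schrodingerOp a b f x / f x : ℝ) : EReal)) f ⟨hf2, hflim, hfpos⟩)
  refine le_iInf₂ fun x hx => ?_
  rw [EReal.coe_le_coe_iff, hLS x hx, neg_neg, mul_div_cancel_right₀ _ (hfpos x hx).ne']

theorem lamDualDD_le_lamS (hθ : 0 < θ) (ha : ContDiffOn ℝ 1 a (Ioi 0))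
    (hb : ContDiffOn ℝ 1 b (Ioi 0)) (ha_pos : ∀ x > 0, 0 < a x)
    (hC : ∃ K : ℝ, ∃ δ > 0, ∀ x ∈ Ioo 0 δ, |logWeight a b θ x| ≤ K)
    (hmi : IntegrableOn (speedDensity a b θ) (Ioi 0)) :
    (lamDualDD a b θ : EReal) ≤ lamS a b := by
  by_contra! hlt
  obtain ⟨r, hr, hr'⟩ := EReal.lt_iff_exists_real_btwn.1 hlt
  refine absurd hr (not_lt.2 ?_)
  refine le_trans (EReal.coe_le_coe_iff.2 (le_max_left r 0))
    (le_lamS_of_lt_lamDualDD hθ ha hb ha_pos hC hmi (le_max_right r 0) ?_)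
  rcases le_or_gt r 0 with h | h
  · exact Or.inl (max_eq_right h)
  · right
    rw [max_eq_left h.le, ← EReal.coe_ennreal_lt_coe_ennreal_iff, EReal.coe_ennreal_ofReal,
      max_eq_left h.le]
    exact hr'

end Coefficients

end HalfLineDiffusion

theorem mainTheorem5 (a b : ℝ → ℝ) (θ : ℝ) (hθ : 0 < θ)
    (ha : ContDiffOn ℝ 1 a (Set.Ioi 0)) (hb : ContDiffOn ℝ 1 b (Set.Ioi 0))
    (ha_pos : ∀ x > 0, 0 < a x)
    (hC : ∃ K : ℝ, ∃ δ > 0, ∀ x ∈ Set.Ioo 0 δ, |HalfLineDiffusion.logWeight a b θ x| ≤ K)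
    (hμ : HalfLineDiffusion.halfLineMeasure (HalfLineDiffusion.speedDensity a b θ) Set.univ < ⊤) :
    (HalfLineDiffusion.lamOne a b θ : EReal) = HalfLineDiffusion.lamS a b ∧
      HalfLineDiffusion.lamS a b = (HalfLineDiffusion.lamDualDD a b θ : EReal) := by
  have hm := (HalfLineDiffusion.contDiffOn_speedDensity hθ ha hb ha_pos).continuousOn
  have hm0 := HalfLineDiffusion.speedDensity_pos ha_pos b θ
  have hmi := HalfLineDiffusion.integrableOn_of_halfLineMeasure_lt_top hm hm0 hμ
  have h1 : (HalfLineDiffusion.lamOne a b θ : EReal) ≤ HalfLineDiffusion.lamDualDD a b θ :=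
    EReal.coe_ennreal_le_coe_ennreal_iff.2 (HalfLineDiffusion.lamNN_le_lamDD_dual hm hm0 hmi
      (HalfLineDiffusion.contDiffOn_scaleDensity hθ ha hb ha_pos).continuousOn
      fun x _ => HalfLineDiffusion.scaleDensity_pos a b θ x)
  have h2 := HalfLineDiffusion.lamDualDD_le_lamS hθ ha hb ha_pos hC hmi
  have h3 := HalfLineDiffusion.lamS_le_lamOne hθ ha hb ha_pos hmi
  exact ⟨le_antisymm (h1.trans h2) h3, le_antisymm (h3.trans h1) h2⟩
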